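/- Consider $N\ge 1$ access points and $M\ge 1$ clients. Time is slotted, and the slots are grouped into intervals of $\tau\ge 1$ slots. In each slot the channel from access point $i$ to client $j$ is on with probability $p_{ij}\in[0,1]$; the channels are independent of each other and i.i.d. over time. At the beginning of each interval every client requests one new packet (undelivered old packets are dropped), and each of these packets is assigned to one access point. In each slot each access point may transmit one packet among those that are assigned to it and not yet delivered; the packet of client $j$ is delivered by access point $i$ if the channel from $i$ to $j$ is on in that slot, and the outcome of the transmission is observed at the end of the slot. A scheduling policy $\eta$ chooses the assignments and the transmissions causally, as a function of the entire observed past; $\mathcal S$ is the set of all policies. Let $N_j(k,\eta)\in\{0,1\}$ indicate whether client $j$ receives its packet in interval $k$. For a random sequence $(a_r)$ read its upper limit as the number $\sup\{R:\ \limsup_{r\to\infty}a_r\ge R \text{ with probability } 1\}$. With this reading let $R_j(\eta)=\limsup_{r\to\infty}\frac1r\sum_{k=1}^r N_j(k,\eta)$ be the timely throughput of client $j$. For weights $\omega_1,\dots,\omega_M\ge 1$ let $$w\text{-}\mathsf T^3(\eta)=\limsup_{r\to\infty}\frac1r\sum_{k=1}^r\sum_{j=1}^M\omega_jN_j(k,\eta)$$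 be the weighted total timely throughput of $\eta$ (if every $\frac1r\sum_{k\le r} N_j(k,\eta)$ converges almost surely to a constant, this is $\sum_j\omega_jR_j(\eta)$), and put $C_{w\text{-}\mathsf T^3}=\sup_{\eta\in\mathcal S}w\text{-}\mathsf T^3(\eta)$ and $\omega_{\max}=\max_j\omega_j$. Let $C_{w\text{-det}}$ be the value of the relaxed (generalized assignment) problem $$\max\ \sum_{i=1}^N\sum_{j=1}^M x_{ij}\omega_j\quad\text{subject to}\quad \sum_{j=1}^M\frac{x_{ij}}{p_{ij}}\le\tau\ \ (1\le i\le N),\qquad \sum_{i=1}^N x_{ij}\le 1\ \ (1\le j\le M),\qquad x_{ij}\in\{0,1\},$$ where $x_{ij}=0$ is required if $p_{ij}=0$. Then $$C_{w\text{-det}}-2\omega_{\max}\sqrt{N\left(C_{w\text{-det}}+\tfrac N4\right)}<C_{w\text{-}\mathsf T^3}<C_{w\text{-det}}+N\omega_{\max}.$$ The same two bounds hold with $C_{w\text{-}\mathsf T^3}$ replaced by the supremum of $\sum_{j=1}^M\omega_jR_j(\eta)$ over all policies $\eta\in\mathcal S$ under which $\frac1r\sum_{k=1}^r N_j(k,\eta)$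 converges almost surely, as $r\to\infty$, for every client $j$. -/

import Mathlib

open MeasureTheory ProbabilityTheory Filter Topology

noncomputable section

namespace TimelyThroughput

/-- The success probabilities of the erasure channels: `p i j` belongs to the channel from access
point `i` to client `j` (it is `0` if there is no link). -/
abbrev Channels (N M : ℕ) := Fin N → Fin M → unitInterval

/-- Sample space: `c (t, i, j)` tells whether the channel from access point `i` to client `j` is
on during time slot `t`. -/
abbrev Outcomes (N M : ℕ) := ℕ × Fin N × Fin M → Bool

/-- The channels are independent of each other and i.i.d. over time; the one from access point `i`
to client `j` is on with probability `p i j` in each slot. -/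
def channelLaw {N M : ℕ} (p : Channels N M) : Measure (Outcomes N M) :=
  Measure.infinitePi fun x : ℕ × Fin N × Fin M => bernoulliMeasure true false (p x.2.1 x.2.2)

/-- What has been observed in one time slot: for each access point, either `none` (it was idle), or
`some (j, b)`: it transmitted the packet of client `j`, and `b` tells whether this packet has been
delivered. -/
abbrev SlotRecord (N M : ℕ) := Fin N → Option (Fin M × Bool)

/-- A list of the records of all past slots, the most recent one first. -/
abbrev History (N M : ℕ) := List (SlotRecord N M)

/-- A causal scheduling policy. Right before an interval, `assign` distributes the `M` requested
packets among the access points; before each slot, `transmit` picks the packet that an access point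
transmits in this slot (or lets it idle). Both decisions are functions of the entire past history
(past decisions of the policy can be computed from it). -/
structure Policy (N M : ℕ) where
  assign : History N M → Fin M → Fin N
  transmit : History N M → Fin N → Option (Fin M)

/-- The state of the network before a time slot. -/
structure State (N M : ℕ) where
  /-- everything observed so far -/
  history : History N M
  /-- the assignment of packets to access points in the current interval -/
  assignment : Fin M → Fin N
  /-- the clients whose packet of the current interval has not been delivered yet -/
  pending : Finset (Fin M)

variable {N M : ℕ}

/-- At the beginning of an interval, undelivered old packets are dropped, each client requests one
new packet, and the new packets are assigned to access points. -/
def beginInterval (η : Policy N M) (h : History N M) : State N M where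
  history := h
  assignment := η.assign h
  pending := Finset.univ

/-- The packet transmitted by access point `i`: only packets that are in its buffer, that is,
assigned to it and not delivered yet, can be transmitted; otherwise it stays idle. -/
def sent (η : Policy N M) (s : State N M) (i : Fin N) : Option (Fin M) :=
  (η.transmit s.history i).filter fun j => decide (s.assignment j = i ∧ j ∈ s.pending)

/-- The record of a slot, given which channels are on in this slot. -/
def slotRecord (η : Policy N M) (s : State N M) (c : Fin N → Fin M → Bool) : SlotRecord N M :=
  fun i => (sent η s i).map fun j => (j, c i j)

/-- One time slot. Delivered packets are removed from the buffers. -/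
def slotStep (η : Policy N M) (s : State N M) (c : Fin N → Fin M → Bool) : State N M where
  history := slotRecord η s c :: s.history
  assignment := s.assignment
  pending := s.pending.filter fun j => ∀ i, slotRecord η s c i ≠ some (j, true)

/-- The state after `n` slots, where `c s` are the channels in the `s`-th of these slots. -/
def runSlots (η : Policy N M) (s₀ : State N M) (c : ℕ → Fin N → Fin M → Bool) : ℕ → State N M
  | 0 => s₀
  | n + 1 => slotStep η (runSlots η s₀ c n) (c n)

/-- The history before the `k`-th interval (`k = 0, 1, …`), when intervals consist of `τ` slots:
interval `k` consists of the slots `k * τ, …, k * τ + τ - 1`. -/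
def historyBefore (τ : ℕ) (η : Policy N M) (c : Outcomes N M) : ℕ → History N M
  | 0 => []
  | k + 1 => (runSlots η (beginInterval η (historyBefore τ η c k))
      (fun s i j => c (k * τ + s, i, j)) τ).history

/-- The state at the end of the `k`-th interval. -/
def endOfInterval (τ : ℕ) (η : Policy N M) (c : Outcomes N M) (k : ℕ) : State N M :=
  runSlots η (beginInterval η (historyBefore τ η c k)) (fun s i j => c (k * τ + s, i, j)) τ

/-- `1` if client `j` receives its packet during interval `k`, and `0` otherwise. -/
def delivered (τ : ℕ) (η : Policy N M) (c : Outcomes N M) (k : ℕ) (j : Fin M) : ℝ :=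
  if j ∈ (endOfInterval τ η c k).pending then 0 else 1

/-- The average number of deliveries to client `j` in the first `r` intervals. -/
def clientAverage (τ : ℕ) (η : Policy N M) (j : Fin M) (c : Outcomes N M) (r : ℕ) : ℝ :=
  (∑ k ∈ Finset.range r, delivered τ η c k j) / r

/-- The average weighted number of deliveries, to all clients, in the first `r` intervals. -/
def weightedAverage (τ : ℕ) (w : Fin M → ℝ) (η : Policy N M) (c : Outcomes N M) (r : ℕ) : ℝ :=
  (∑ k ∈ Finset.range r, ∑ j, w j * delivered τ η c k j) / r

/-- The number that the upper limit of the random sequence `a` is almost surely not below: the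
largest `R` such that `limsup a ≥ R` with probability one. -/
def almostSureLimsup (P : Measure (Outcomes N M)) (a : Outcomes N M → ℕ → ℝ) : ℝ :=
  sSup {R : ℝ | ∀ᵐ c ∂P, R ≤ limsup (a c) atTop}

/-- The timely throughput `R_j(η)` of client `j`. -/
def timelyThroughput (τ : ℕ) (p : Channels N M) (η : Policy N M) (j : Fin M) : ℝ :=
  almostSureLimsup (channelLaw p) (clientAverage τ η j)

/-- The weighted total timely throughput of a policy: its long-term average weighted number of
deliveries. -/
def weightedThroughput (τ : ℕ) (p : Channels N M) (w : Fin M → ℝ) (η : Policy N M) : ℝ :=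
  almostSureLimsup (channelLaw p) (weightedAverage τ w η)

/-- The weighted capacity: the supremum, over all policies, of the weighted total timely
throughput. -/
def weightedCapacity (τ : ℕ) (p : Channels N M) (w : Fin M → ℝ) : ℝ :=
  ⨆ η : Policy N M, weightedThroughput τ p w η

/-- The long-term average number of deliveries to each client exists as a limit. -/
def HasLongTermAverages (τ : ℕ) (p : Channels N M) (η : Policy N M) : Prop :=
  ∀ j, ∀ᵐ c ∂(channelLaw p), ∃ R : ℝ, Tendsto (clientAverage τ η j c) atTop (𝓝 R)

/-- The supremum of `∑ j, w j * R_j(η)` over the policies `η` under which the long-term averages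
of all clients exist. -/
def weightedCapacityOfLimits (τ : ℕ) (p : Channels N M) (w : Fin M → ℝ) : ℝ :=
  ⨆ η : {η : Policy N M // HasLongTermAverages τ p η},
    ∑ j, w j * timelyThroughput τ p η.1 j

/-- Feasible points of the relaxed problem: client `j`, if put into bin `i`, has size `1 / p i j`
there, each bin has capacity `τ`, and each client is put into at most one bin. An infinite size
(`p i j = 0`) does not fit. -/
structure IsFeasible (τ : ℕ) (p : Channels N M) (x : Fin N → Fin M → ℝ) : Prop where
  zero_or_one : ∀ i j, x i j = 0 ∨ x i j = 1
  no_link : ∀ i j, (p i j : ℝ) = 0 → x i j = 0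
  capacity : ∀ i, ∑ j, x i j / (p i j : ℝ) ≤ τ
  at_most_one_bin : ∀ j, ∑ i, x i j ≤ 1

/-- The value of the weighted relaxed problem (a generalized assignment problem); the maximum is
over a finite nonempty set. -/
def weightedDet (τ : ℕ) (p : Channels N M) (w : Fin M → ℝ) : ℝ :=
  sSup {v : ℝ | ∃ x : Fin N → Fin M → ℝ, IsFeasible τ p x ∧ v = ∑ i, ∑ j, x i j * w j}

end TimelyThroughput

end

/-! Upper bound. Fix the past, hence the assignment `a` of one interval, and let `U j` be the
expected number of transmissions of packet `j`. Each transmission succeeds with probability `p (a j)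
j` independently of the past, so, as in Wald's identity, `j` is delivered with probability `p (a j)
j * U j`, while every access point spends at most `τ` slots (`exists_airtime`). The delivery
probabilities thus solve fractional knapsack problems, one per access point, with sizes `1 / p`.
Rounding each of them loses less than one maximal weight (`exists_knapsack_packing`), and there are
finitely many assignments, so one `B` strictly below the claimed bound dominates all conditional
means (`exists_interval_bound`). An exponential supermartingale and Borel–Cantelli carry `B` over to
long-run averages.

Lower bound. Given a feasible point, let each access point serve its targets in order of decreasing
success probability. With `D` the remaining targets, the squared delay against the expected
schedule, scaled by the current rate, plus `|D|` is a supermartingale (`potential_step`). It starts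
at the number of targets and ends above `|D| ^ 2`. Cauchy–Schwarz bounds the expected total loss by
`√(N * number of targets)` packets, and weights are at least `1`, so the number of targets is at
most the value of the point. This policy repeats itself in every interval, so its averages converge
and it serves both capacities. -/

noncomputable section

namespace TimelyThroughput

variable {N M : ℕ}

/-! ### Independence of the past and the future of the channels -/

instance (p : Channels N M) : IsProbabilityMeasure (channelLaw p) := by
  unfold channelLaw; infer_instance

/-- The channels from slot `m` on. -/
def shift (m : ℕ) (c : Outcomes N M) : Outcomes N M := fun x => c (m + x.1, x.2)

/-- The channels of the slots before slot `m`. -/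
def slotsBefore (N M m : ℕ) : Set (ℕ × Fin N × Fin M) := {x | x.1 < m}

/-- The channels are those of `q.1` before slot `m`, and those of `q.2` from slot `m` on. -/
def splice (m : ℕ) (q : Outcomes N M × Outcomes N M) : Outcomes N M :=
  fun x => if x.1 < m then q.1 x else q.2 (x.1 - m, x.2)

lemma measurable_splice (m : ℕ) : Measurable (splice (N := N) (M := M) m) := by
  refine measurable_pi_lambda _ fun x => ?_
  unfold splice
  split_ifs <;> fun_prop

lemma shift_splice (m : ℕ) (q : Outcomes N M × Outcomes N M) : shift m (splice m q) = q.2 := by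
  funext x
  simp [shift, splice]

/-- A product measure is determined by finite boxes. The preimage of a box is a box in the slots
before `m` times a box in the later slots moved back by `m`, and the success probabilities do not
depend on the slot. -/
lemma measurePreserving_splice (p : Channels N M) (m : ℕ) :
    MeasurePreserving (splice m) ((channelLaw p).prod (channelLaw p)) (channelLaw p) := by
  refine ⟨measurable_splice m, ?_⟩
  refine Measure.eq_infinitePi _ fun s t ht => ?_
  rw [Measure.map_apply (measurable_splice m)
    (MeasurableSet.pi s.countable_toSet fun i _ => ht i)]
  have hpre : splice m ⁻¹' (Set.pi (s : Set (ℕ × Fin N × Fin M)) t) =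
      (Set.pi (s.filter fun x => x.1 < m : Finset _) t) ×ˢ
      (Set.pi ((s.filter fun x => ¬ x.1 < m).image fun x => (x.1 - m, x.2) : Finset _)
        fun x => t (m + x.1, x.2)) := by
    ext q
    simp only [Set.mem_preimage, Set.mem_pi, Set.mem_prod, Finset.mem_coe, Finset.mem_filter,
      Finset.mem_image]
    constructor
    · intro h
      refine ⟨fun x hx => by simpa [splice, hx.2] using h x hx.1, ?_⟩
      rintro _ ⟨x, hx, rfl⟩
      have h2 := h x hx.1
      have hm : m + (x.1 - m) = x.1 := by omega
      simpa [splice, hx.2, hm] using h2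
    · rintro ⟨h1, h2⟩ x hx
      by_cases hxm : x.1 < m
      · simpa [splice, hxm] using h1 x ⟨hx, hxm⟩
      · have hm : m + (x.1 - m) = x.1 := by omega
        simpa [splice, hxm, hm] using h2 _ ⟨x, ⟨hx, hxm⟩, rfl⟩
  rw [hpre, Measure.prod_prod]
  unfold channelLaw
  rw [Measure.infinitePi_pi _ fun i _ => ht i, Measure.infinitePi_pi _ fun i _ => ht _,
    Finset.prod_image, ← Finset.prod_filter_mul_prod_filter_not s (fun x => x.1 < m)]
  · congr 1
    refine Finset.prod_congr rfl fun x hx => ?_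
    have hm : m + (x.1 - m) = x.1 := by
      have := (Finset.mem_filter.1 hx).2
      omega
    simp [hm]
  · intro x hx y hy hxy
    have h1 := (Finset.mem_filter.1 hx).2
    have h2 := (Finset.mem_filter.1 hy).2
    simp only [Prod.mk.injEq] at hxy
    exact Prod.ext (by omega) hxy.2

lemma finite_slotsBefore (N M m : ℕ) : (slotsBefore N M m).Finite := by
  have : slotsBefore N M m ⊆ Set.Iio m ×ˢ Set.univ := fun x hx => ⟨hx, trivial⟩
  exact ((Set.finite_Iio m).prod Set.finite_univ).subset this

/-- Extends a function of the channels before slot `m` by `false`. -/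
def truncate (m : ℕ) (c : Outcomes N M) : Outcomes N M := fun x => if x.1 < m then c x else false

/-- Finitely many slots have finitely many outcomes, so whatever depends on them alone is bounded;
this removes most integrability side conditions. -/
lemma finite_range_truncate (m : ℕ) : (Set.range (truncate (N := N) (M := M) m)).Finite := by
  have := (finite_slotsBefore N M m).to_subtype
  let e : (slotsBefore N M m → Bool) → Outcomes N M :=
    fun d x => if h : x.1 < m then d ⟨x, h⟩ else false
  refine (Set.finite_range e).subset ?_
  rintro _ ⟨c, rfl⟩
  exact ⟨fun x => c x, by funext x; simp [e, truncate]⟩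

lemma DependsOn.comp_truncate {β : Type*} {m : ℕ} {f : Outcomes N M → β}
    (hf : DependsOn f (slotsBefore N M m)) (c : Outcomes N M) : f (truncate m c) = f c :=
  hf fun x hx => by
    have : x.1 < m := hx
    simp [truncate, this]

lemma DependsOn.measurable {β : Type*} [MeasurableSpace β] {m : ℕ} {f : Outcomes N M → β}
    (hf : DependsOn f (slotsBefore N M m)) : Measurable f := by
  have := (finite_slotsBefore N M m).to_subtype
  have hf' : f = (fun d : slotsBefore N M m → Bool =>
      f fun x => if h : x.1 < m then d ⟨x, h⟩ else false) ∘ fun c x => c x := by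
    funext c
    refine hf fun x hx => ?_
    have : x.1 < m := hx
    simp [this]
  rw [hf']
  exact (measurable_of_finite _).comp (by fun_prop)

lemma DependsOn.exists_bound {m : ℕ} {f : Outcomes N M → ℝ}
    (hf : DependsOn f (slotsBefore N M m)) : ∃ C, ∀ c, |f c| ≤ C := by
  obtain ⟨C, hC⟩ := ((finite_range_truncate (N := N) (M := M) m).image fun c => |f c|).bddAbove
  refine ⟨C, fun c => ?_⟩
  rw [← DependsOn.comp_truncate hf c]
  exact hC ⟨_, ⟨c, rfl⟩, rfl⟩

lemma DependsOn.integrable {m : ℕ} {f : Outcomes N M → ℝ}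
    (hf : DependsOn f (slotsBefore N M m)) (μ : Measure (Outcomes N M)) [IsFiniteMeasure μ] :
    Integrable f μ := by
  obtain ⟨C, hC⟩ := DependsOn.exists_bound hf
  exact Integrable.of_bound (DependsOn.measurable hf).aestronglyMeasurable C
    (ae_of_all _ fun c => by simpa using hC c)

/-- The past and the future of the channels are independent, and the future is distributed like the
whole sequence. -/
theorem integral_past_future (p : Channels N M) {m l : ℕ} {F : Outcomes N M → Outcomes N M → ℝ}
    (hF₁ : ∀ d, DependsOn (fun c => F c d) (slotsBefore N M m))
    (hF₂ : ∀ c, DependsOn (F c) (slotsBefore N M l)) :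
    ∫ c, F c (shift m c) ∂(channelLaw p) =
      ∫ c, ∫ d, F c d ∂(channelLaw p) ∂(channelLaw p) := by
  have hdep : DependsOn (fun c => F c (shift m c)) (slotsBefore N M (m + l)) := by
    intro c d h
    have h1 : F c (shift m c) = F d (shift m c) :=
      hF₁ _ fun x hx => h x (show x.1 < m + l from Nat.lt_add_right l hx)
    have h2 : F d (shift m c) = F d (shift m d) :=
      hF₂ _ fun x hx => h _ (show m + x.1 < m + l from Nat.add_lt_add_left hx m)
    exact h1.trans h2
  -- Under the splicing the two arguments of `F` become independent copies, and Fubini finishes.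
  have hsp : ∀ q : Outcomes N M × Outcomes N M,
      F (splice m q) (shift m (splice m q)) = F q.1 q.2 := by
    intro q
    rw [shift_splice]
    refine hF₁ _ fun x hx => ?_
    have : x.1 < m := hx
    simp [splice, this]
  have hmp := measurePreserving_splice p m
  obtain ⟨C, hC⟩ := DependsOn.exists_bound hdep
  have hmeas := (DependsOn.measurable hdep).aestronglyMeasurable (μ := channelLaw p)
  have hint : Integrable (fun q : Outcomes N M × Outcomes N M => F q.1 q.2)
      ((channelLaw p).prod (channelLaw p)) := by
    have := hmp.integrable_comp_of_integrable (DependsOn.integrable hdep (channelLaw p))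
    simpa [Function.comp_def, hsp] using this
  calc ∫ c, F c (shift m c) ∂(channelLaw p)
      = ∫ q, F (splice m q) (shift m (splice m q)) ∂((channelLaw p).prod (channelLaw p)) := by
        rw [← hmp.map_eq] at hmeas
        conv_lhs => rw [← hmp.map_eq]
        rw [integral_map hmp.measurable.aemeasurable hmeas]
    _ = ∫ q, F q.1 q.2 ∂((channelLaw p).prod (channelLaw p)) := by simp_rw [hsp]
    _ = _ := integral_prod _ hint

lemma measureReal_channel_on (p : Channels N M) (t : ℕ) (i : Fin N) (j : Fin M) :
    (channelLaw p).real {c | c (t, i, j) = true} = p i j := by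
  have h := Measure.infinitePi_map_eval
    (fun x : ℕ × Fin N × Fin M => bernoulliMeasure true false (p x.2.1 x.2.2)) (t, i, j)
  have : (channelLaw p).real {c | c (t, i, j) = true} =
      ((channelLaw p).map fun c => c (t, i, j)).real {true} := by
    rw [map_measureReal_apply (by fun_prop) (by measurability)]
    rfl
  rw [this]
  unfold channelLaw
  rw [h, bernoulliMeasure_real_apply_of_mem_of_notMem] <;> simp

lemma integral_ite_channel_on (p : Channels N M) (t : ℕ) (i : Fin N) (j : Fin M) (a b : ℝ) :
    ∫ c, (if c (t, i, j) = true then a else b) ∂(channelLaw p) = p i j * a + (1 - p i j) * b := by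
  have hm : MeasurableSet {c : Outcomes N M | c (t, i, j) = true} :=
    measurableSet_eq_fun (by fun_prop) (by fun_prop)
  have : (fun c : Outcomes N M => if c (t, i, j) = true then a else b) =
      fun c => b + {c : Outcomes N M | c (t, i, j) = true}.indicator (fun _ => a - b) c := by
    funext c
    by_cases h : c (t, i, j) = true <;> simp [h]
  rw [this, integral_add (integrable_const _) ((integrable_const _).indicator hm),
    integral_indicator_const _ hm, measureReal_channel_on]
  simp
  ring

/-! ### A law of large numbers for rewards that depend on the past -/

/-- Uses `exp u ≤ 1 + u + u ^ 2` for `|u| ≤ 1`; the linear term has nonpositive mean. -/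
lemma integral_exp_le {Ω : Type*} [MeasurableSpace Ω] (μ : Measure Ω) [IsProbabilityMeasure μ]
    {f : Ω → ℝ} (hf : Integrable f μ) {K l : ℝ} (hfK : ∀ ω, |f ω| ≤ K) (hl : 0 ≤ l)
    (hlK : l * K ≤ 1) (hmean : ∫ ω, f ω ∂μ ≤ 0) :
    ∫ ω, Real.exp (l * f ω) ∂μ ≤ Real.exp ((l * K) ^ 2) := by
  have hpt : ∀ ω, Real.exp (l * f ω) ≤ 1 + (l * K) ^ 2 + l * f ω := by
    intro ω
    have h1 : |l * f ω| ≤ l * K := by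
      rw [abs_mul, abs_of_nonneg hl]
      exact mul_le_mul_of_nonneg_left (hfK ω) hl
    have h2 := (abs_le.1 (Real.abs_exp_sub_one_sub_id_le (h1.trans hlK))).2
    have h3 : (l * f ω) ^ 2 ≤ (l * K) ^ 2 := sq_le_sq' (abs_le.1 h1).1 (abs_le.1 h1).2
    linarith
  calc ∫ ω, Real.exp (l * f ω) ∂μ ≤ ∫ ω, (1 + (l * K) ^ 2 + l * f ω) ∂μ :=
        integral_mono_of_nonneg (ae_of_all _ fun ω => (Real.exp_pos _).le)
          ((integrable_const _).add (hf.const_mul l)) (ae_of_all _ hpt)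
    _ = 1 + (l * K) ^ 2 + l * ∫ ω, f ω ∂μ := by
        rw [integral_add (integrable_const _) (hf.const_mul l), integral_const_mul]
        simp
    _ ≤ (l * K) ^ 2 + 1 := by nlinarith
    _ ≤ _ := Real.add_one_le_exp _

section Rewards

variable {τ : ℕ} {g : ℕ → Outcomes N M → Outcomes N M → ℝ}

/-- In `g k c d`, the past `c` is read only before interval `k`, and `d` stands for the channels
from its first slot on. -/
lemma dependsOn_sum_rewards
    (hg₁ : ∀ k d, DependsOn (fun c => g k c d) (slotsBefore N M (k * τ)))
    (hg₂ : ∀ k c, DependsOn (g k c) (slotsBefore N M τ)) (r : ℕ) :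
    DependsOn (fun c => ∑ k ∈ Finset.range r, g k c (shift (k * τ) c))
      (slotsBefore N M (r * τ)) := by
  intro c d h
  refine Finset.sum_congr rfl fun k hk => ?_
  have hk' : (k + 1) * τ ≤ r * τ := Nat.mul_le_mul_right τ (Finset.mem_range.1 hk)
  rw [add_mul, one_mul] at hk'
  have h1 : g k c (shift (k * τ) c) = g k d (shift (k * τ) c) :=
    hg₁ k _ fun x hx => h x <| by
      have : x.1 < k * τ := hx
      exact show x.1 < r * τ by omega
  have h2 : g k d (shift (k * τ) c) = g k d (shift (k * τ) d) :=
    hg₂ k _ fun x hx => h _ <| by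
      have : x.1 < τ := hx
      exact show k * τ + x.1 < r * τ by omega
  exact h1.trans h2

/-- Conditioning on the past of the last interval peels off one factor `exp ((l * K) ^ 2)` at a
time. -/
lemma integral_exp_sum_rewards_le (p : Channels N M)
    (hg₁ : ∀ k d, DependsOn (fun c => g k c d) (slotsBefore N M (k * τ)))
    (hg₂ : ∀ k c, DependsOn (g k c) (slotsBefore N M τ)) {K l : ℝ}
    (hgK : ∀ k c d, |g k c d| ≤ K) (hl : 0 ≤ l) (hlK : l * K ≤ 1)
    (hmean : ∀ k c, ∫ d, g k c d ∂(channelLaw p) ≤ 0) (r : ℕ) :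
    ∫ c, Real.exp (l * ∑ k ∈ Finset.range r, g k c (shift (k * τ) c)) ∂(channelLaw p) ≤
      Real.exp (r * (l * K) ^ 2) := by
  induction r with
  | zero => simp
  | succ r ih =>
    have hdep := dependsOn_sum_rewards hg₁ hg₂ r
    have hint : Integrable (fun c => Real.exp (l * ∑ k ∈ Finset.range r, g k c (shift (k * τ) c)))
        (channelLaw p) :=
      DependsOn.integrable (m := r * τ) (fun c d h => by simp only [hdep h]) _
    calc ∫ c, Real.exp (l * ∑ k ∈ Finset.range (r + 1), g k c (shift (k * τ) c)) ∂(channelLaw p)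
        = ∫ c, Real.exp (l * ∑ k ∈ Finset.range r, g k c (shift (k * τ) c)) *
            Real.exp (l * g r c (shift (r * τ) c)) ∂(channelLaw p) := by
          simp_rw [Finset.sum_range_succ, mul_add, Real.exp_add]
      _ = ∫ c, ∫ d, Real.exp (l * ∑ k ∈ Finset.range r, g k c (shift (k * τ) c)) *
            Real.exp (l * g r c d) ∂(channelLaw p) ∂(channelLaw p) :=
          integral_past_future p (m := r * τ) (l := τ)
            (F := fun c d => Real.exp (l * ∑ k ∈ Finset.range r, g k c (shift (k * τ) c)) *
              Real.exp (l * g r c d))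
            (fun d c c' h => by
              have h1 := hdep h
              have h2 := hg₁ r d h
              simp only at h1 h2
              simp only [h1, h2])
            (fun c d d' h => by simp only [hg₂ r c h])
      _ = ∫ c, Real.exp (l * ∑ k ∈ Finset.range r, g k c (shift (k * τ) c)) *
            ∫ d, Real.exp (l * g r c d) ∂(channelLaw p) ∂(channelLaw p) := by
          simp_rw [integral_const_mul]
      _ ≤ ∫ c, Real.exp (l * ∑ k ∈ Finset.range r, g k c (shift (k * τ) c)) *
            Real.exp ((l * K) ^ 2) ∂(channelLaw p) := by
          refine integral_mono_of_nonneg (ae_of_all _ fun c => ?_) (hint.mul_const _)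
            (ae_of_all _ fun c => ?_)
          · exact mul_nonneg (Real.exp_pos _).le (integral_nonneg fun d => (Real.exp_pos _).le)
          · exact mul_le_mul_of_nonneg_left
              (integral_exp_le _ (DependsOn.integrable (hg₂ r c) _) (hgK r c) hl hlK (hmean r c))
              (Real.exp_pos _).le
      _ ≤ Real.exp (r * (l * K) ^ 2) * Real.exp ((l * K) ^ 2) := by
          rw [integral_mul_const]
          exact mul_le_mul_of_nonneg_right ih (Real.exp_pos _).le
      _ = Real.exp ((r + 1 : ℕ) * (l * K) ^ 2) := by
          rw [← Real.exp_add]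
          push_cast
          ring_nf

/-- If the reward of each interval has a nonpositive conditional mean, then almost surely the
averages of the rewards are eventually below any positive number. -/
theorem ae_eventually_sum_rewards_le (p : Channels N M)
    (hg₁ : ∀ k d, DependsOn (fun c => g k c d) (slotsBefore N M (k * τ)))
    (hg₂ : ∀ k c, DependsOn (g k c) (slotsBefore N M τ)) {K : ℝ} (hK : 0 < K)
    (hgK : ∀ k c d, |g k c d| ≤ K) (hmean : ∀ k c, ∫ d, g k c d ∂(channelLaw p) ≤ 0)
    {ε : ℝ} (hε : 0 < ε) :
    ∀ᵐ c ∂(channelLaw p), ∀ᶠ r : ℕ in atTop,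
      ∑ k ∈ Finset.range r, g k c (shift (k * τ) c) ≤ ε * r := by
  -- The tilt `l` must be so small that the quadratic cost per interval stays below the gain `l *
  -- ε`.
  obtain ⟨l, hl, hlK, hlε⟩ : ∃ l : ℝ, 0 < l ∧ l * K ≤ 1 ∧ (l * K) ^ 2 < l * ε := by
    have hpos : 0 < 2 * K ^ 2 + ε * K := by positivity
    refine ⟨ε / (2 * K ^ 2 + ε * K), by positivity, ?_, ?_⟩
    · rw [div_mul_eq_mul_div, div_le_one hpos]
      nlinarith [sq_nonneg K]
    · rw [div_mul_eq_mul_div, div_pow, div_mul_eq_mul_div, div_lt_div_iff₀ (by positivity) hpos]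
      have : 0 < ε ^ 2 * (2 * K ^ 2 + ε * K) * (K ^ 2 + ε * K) := by positivity
      nlinarith
  set q : ℝ := Real.exp ((l * K) ^ 2 - l * ε) with hq
  have hq1 : q < 1 := by
    rw [hq, Real.exp_lt_one_iff]
    linarith
  -- The Chernoff bound is geometric in `r`, hence summable, as Borel–Cantelli requires.
  have hbound : ∀ r : ℕ, channelLaw p
      {c | ε * r ≤ ∑ k ∈ Finset.range r, g k c (shift (k * τ) c)} ≤ ENNReal.ofReal (q ^ r) := by
    intro r
    have hdep := dependsOn_sum_rewards hg₁ hg₂ r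
    have hint : Integrable (fun c => Real.exp (l * ∑ k ∈ Finset.range r, g k c (shift (k * τ) c)))
        (channelLaw p) :=
      DependsOn.integrable (m := r * τ) (fun c d h => by simp only [hdep h]) _
    have h1 := measure_ge_le_exp_mul_mgf (μ := channelLaw p) (ε * r) hl.le hint
    have h2 := integral_exp_sum_rewards_le p hg₁ hg₂ hgK hl.le hlK hmean r
    rw [← ENNReal.ofReal_toReal (measure_ne_top (channelLaw p) _)]
    refine ENNReal.ofReal_le_ofReal (h1.trans ?_)
    calc Real.exp (-l * (ε * r)) * mgf _ (channelLaw p) l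
        ≤ Real.exp (-l * (ε * r)) * Real.exp (r * (l * K) ^ 2) :=
          mul_le_mul_of_nonneg_left h2 (Real.exp_pos _).le
      _ = q ^ r := by
          rw [← Real.exp_add, hq, ← Real.exp_nat_mul]
          ring_nf
  have hsum : ∑' r : ℕ, channelLaw p
      {c | ε * r ≤ ∑ k ∈ Finset.range r, g k c (shift (k * τ) c)} ≠ ⊤ := by
    refine ne_top_of_le_ne_top ?_ (ENNReal.tsum_le_tsum hbound)
    exact (summable_geometric_of_lt_one (Real.exp_pos _).le hq1).tsum_ofReal_ne_top
  filter_upwards [ae_eventually_notMem hsum] with c hc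
  filter_upwards [hc] with r hr
  exact (not_le.1 hr).le

end Rewards

/-! ### Dependence of the state on the channels -/

lemma dependsOn_runSlots (η : Policy N M) (s₀ : State N M) (n : ℕ) :
    DependsOn (fun c : Outcomes N M => runSlots η s₀ (fun s i j => c (s, i, j)) n)
      (slotsBefore N M n) := by
  induction n with
  | zero => exact fun _ _ _ => rfl
  | succ n ih =>
    intro c d h
    have h1 := ih (x := c) (y := d) fun x hx => h x (Nat.lt_succ_of_lt hx)
    have h2 : (fun i j => c (n, i, j)) = fun i j => d (n, i, j) := by
      funext i j
      exact h (n, i, j) (Nat.lt_succ_self n)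
    simp only at h1
    simp only [runSlots, h1, h2]

lemma dependsOn_historyBefore (τ : ℕ) (η : Policy N M) (k : ℕ) :
    DependsOn (fun c : Outcomes N M => historyBefore τ η c k) (slotsBefore N M (k * τ)) := by
  induction k with
  | zero => exact fun _ _ _ => rfl
  | succ k ih =>
    intro c d h
    have h1 := ih (x := c) (y := d) fun x hx => h x <| by
      have : x.1 < k * τ := hx
      exact show x.1 < (k + 1) * τ by rw [add_mul]; omega
    have h2 := dependsOn_runSlots η (beginInterval η (historyBefore τ η d k)) τ
      (x := shift (k * τ) c) (y := shift (k * τ) d) fun x hx => h _ <| by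
        have : x.1 < τ := hx
        exact show k * τ + x.1 < (k + 1) * τ by rw [add_mul]; omega
    simp only at h1
    simp only [historyBefore, h1]
    exact congrArg State.history h2

/-- The channels of the next slot are independent of the past. -/
lemma integral_next_slot (p : Channels N M) {σ : Type*} {n : ℕ} {X : Outcomes N M → σ}
    (hX : DependsOn X (slotsBefore N M n)) (f : σ → (Fin N → Fin M → Bool) → ℝ) :
    ∫ c, f (X c) (fun i j => c (n, i, j)) ∂(channelLaw p) =
      ∫ c, ∫ d, f (X c) (fun i j => d (0, i, j)) ∂(channelLaw p) ∂(channelLaw p) :=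
  integral_past_future p (m := n) (l := 1) (F := fun c d => f (X c) (fun i j => d (0, i, j)))
    (fun d c c' h => by simp only [hX h])
    (fun c d d' h => by
      have : (fun i j => d (0, i, j)) = fun i j => d' (0, i, j) := by
        funext i j
        exact h (0, i, j) Nat.zero_lt_one
      simp only [this])

/-! ### Airtime used in one interval -/

lemma assignment_runSlots (η : Policy N M) (s₀ : State N M) (c : ℕ → Fin N → Fin M → Bool)
    (n : ℕ) : (runSlots η s₀ c n).assignment = s₀.assignment := by
  induction n with
  | zero => rfl
  | succ n ih => exact ih

lemma sent_eq_some {η : Policy N M} {s : State N M} {i : Fin N} {j : Fin M}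
    (h : sent η s i = some j) : s.assignment j = i ∧ j ∈ s.pending := by
  unfold sent at h
  simpa using (Option.filter_eq_some_iff.1 h).2

lemma slotRecord_eq_some_true {η : Policy N M} {s : State N M} {c : Fin N → Fin M → Bool}
    {i : Fin N} {j : Fin M} :
    slotRecord η s c i = some (j, true) ↔ sent η s i = some j ∧ c i j = true := by
  unfold slotRecord
  cases h : sent η s i with
  | none => simp
  | some k =>
    simp only [Option.map_some, Option.some.injEq, Prod.mk.injEq]
    constructor
    · rintro ⟨rfl, h⟩; exact ⟨rfl, h⟩
    · rintro ⟨rfl, h⟩; exact ⟨rfl, h⟩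

/-- `sent` only lets through packets in the sender's own buffer, so the condition on all access
points reduces to the assigned one. -/
lemma mem_pending_slotStep {η : Policy N M} {s : State N M} {c : Fin N → Fin M → Bool}
    {j : Fin M} :
    j ∈ (slotStep η s c).pending ↔
      j ∈ s.pending ∧ ¬ (sent η s (s.assignment j) = some j ∧ c (s.assignment j) j = true) := by
  simp only [slotStep, Finset.mem_filter, ne_eq, slotRecord_eq_some_true, and_congr_right_iff]
  intro _
  constructor
  · exact fun h => h _
  · rintro h i ⟨h1, h2⟩
    obtain rfl := (sent_eq_some h1).1
    exact h ⟨h1, h2⟩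

/-- The one-slot form of Wald's identity: a packet that is sent is still pending, so its delivery
indicator jumps from `0` with probability `p`. -/
lemma integral_delivered_slotStep (p : Channels N M) (η : Policy N M) (s : State N M)
    (j : Fin M) :
    ∫ d, (if j ∈ (slotStep η s fun i j => d (0, i, j)).pending then (0 : ℝ) else 1)
        ∂(channelLaw p) =
      (if j ∈ s.pending then 0 else 1) +
        p (s.assignment j) j * if sent η s (s.assignment j) = some j then 1 else 0 := by
  simp only [mem_pending_slotStep]
  by_cases hs : sent η s (s.assignment j) = some j
  · have := integral_ite_channel_on p 0 (s.assignment j) j 1 0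
    simp only [(sent_eq_some hs).2, hs, true_and, ite_not]
    simpa using this
  · simp [hs]

/-- In each interval, the delivery probabilities are the products of the success probabilities and
the expected numbers of transmissions, and no access point transmits more than once per slot. -/
lemma exists_airtime (p : Channels N M) (η : Policy N M) (h : History N M) (n : ℕ) :
    ∃ U : Fin M → ℝ, (∀ j, 0 ≤ U j) ∧
      (∀ j, ∫ c, (if j ∈ (runSlots η (beginInterval η h) (fun s i j => c (s, i, j)) n).pending
        then (0 : ℝ) else 1) ∂(channelLaw p) = p (η.assign h j) j * U j) ∧
      ∀ i, ∑ j with η.assign h j = i, U j ≤ n := by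
  induction n with
  | zero => exact ⟨fun _ => 0, by simp, by simp [runSlots, beginInterval], by simp⟩
  | succ n ih =>
    obtain ⟨U, hU0, hU, hUn⟩ := ih
    set X : Outcomes N M → State N M :=
      fun c => runSlots η (beginInterval η h) (fun s i j => c (s, i, j)) n with hXdef
    have hX : DependsOn X (slotsBefore N M n) := dependsOn_runSlots η _ n
    have hXa : ∀ c, (X c).assignment = η.assign h := fun c => assignment_runSlots _ _ _ _
    have hint : ∀ f : State N M → ℝ, Integrable (fun c => f (X c)) (channelLaw p) := fun f =>
      DependsOn.integrable (m := n) (fun c d hcd => by simp only [hX hcd]) _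
    have hintu := fun j => hint fun s => if sent η s (η.assign h j) = some j then 1 else 0
    -- The airtime of `j` grows by the probability that `j` is sent in slot `n`.
    refine ⟨fun j => U j + ∫ c, (if sent η (X c) (η.assign h j) = some j then 1 else 0)
      ∂(channelLaw p), fun j => add_nonneg (hU0 j) (integral_nonneg fun c => ?_), fun j => ?_,
      fun i => ?_⟩
    · simp only [Pi.zero_apply]; split_ifs <;> norm_num
    · have := integral_next_slot p hX
        (fun s a => if j ∈ (slotStep η s a).pending then (0 : ℝ) else 1)
      simp only [integral_delivered_slotStep, hXa] at this
      rw [integral_add (hint fun s => if j ∈ s.pending then 0 else 1) ((hintu j).const_mul _),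
        hU, integral_const_mul, ← mul_add] at this
      exact this
    · rw [Finset.sum_add_distrib, ← integral_finsetSum _ fun j _ => hintu j]
      push_cast
      refine add_le_add (hUn i) ?_
      calc ∫ c, ∑ j with η.assign h j = i, (if sent η (X c) (η.assign h j) = some j then (1 : ℝ)
            else 0) ∂(channelLaw p) ≤ ∫ _, 1 ∂(channelLaw p) := by
            refine integral_mono (integrable_finsetSum _ fun j _ => hintu j)
              (integrable_const _) fun c => ?_
            have hle : ∑ j with η.assign h j = i,
                (if sent η (X c) (η.assign h j) = some j then (1 : ℝ) else 0) ≤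
                ∑ j : Fin M, if sent η (X c) i = some j then (1 : ℝ) else 0 := by
              rw [Finset.sum_filter]
              refine Finset.sum_le_sum fun j _ => ?_
              split_ifs <;> simp_all
            refine hle.trans ?_
            cases hs : sent η (X c) i <;> simp
        _ = 1 := by simp

/-! ### The relaxed problem -/

/-- Rounding in the knapsack problem: the fractional optimum exceeds the integral one by less than
the largest weight. -/
lemma exists_knapsack_packing {ι : Type*} [DecidableEq ι] {s w : ι → ℝ} {W : ℝ} (hW : 0 < W)
    (S : Finset ι) (hs : ∀ j ∈ S, 0 < s j) (hw : ∀ j ∈ S, 0 < w j) (hwW : ∀ j ∈ S, w j ≤ W)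
    {C : ℝ} (hC : 0 ≤ C) :
    ∃ T ⊆ S, ∑ j ∈ T, s j ≤ C ∧ ∃ B < ∑ j ∈ T, w j + W, ∀ y : ι → ℝ, (∀ j ∈ S, 0 ≤ y j) →
      (∀ j ∈ S, y j ≤ 1) → ∑ j ∈ S, s j * y j ≤ C → ∑ j ∈ S, w j * y j ≤ B := by
  induction S using Finset.strongInduction generalizing C with
  | H S ih =>
  rcases S.eq_empty_or_nonempty with rfl | hne
  · exact ⟨∅, subset_rfl, by simpa, 0, by simpa, by simp⟩
  -- Greedy choice by density. If the densest item `k` does not fit, the fractional value is at most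
  -- density times `C`, below `w k`; otherwise `k` is packed and the rest is handled with capacity
  -- `C - s k`.
  obtain ⟨k, hk, hmax⟩ := S.exists_max_image (fun j => w j / s j) hne
  have hsk := hs k hk
  have hwk := hw k hk
  have hdens : ∀ j ∈ S, w j ≤ w k / s k * s j := fun j hj => (div_le_iff₀ (hs j hj)).1 (hmax j hj)
  have hdens0 : 0 ≤ w k / s k := by positivity
  have hbd : ∀ S' ⊆ S, ∀ y : ι → ℝ, (∀ j ∈ S, 0 ≤ y j) →
      ∑ j ∈ S', w j * y j ≤ w k / s k * ∑ j ∈ S', s j * y j := by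
    intro S' hS' y hy
    rw [Finset.mul_sum]
    refine Finset.sum_le_sum fun j hj => ?_
    rw [← mul_assoc]
    exact mul_le_mul_of_nonneg_right (hdens j (hS' hj)) (hy j (hS' hj))
  rcases lt_or_ge C (s k) with hCk | hCk
  · refine ⟨∅, by simp, by simpa, w k / s k * C, ?_, fun y hy0 _ hyC =>
      (hbd S subset_rfl y hy0).trans (mul_le_mul_of_nonneg_left hyC hdens0)⟩
    have : w k / s k * C < w k := by
      rw [div_mul_eq_mul_div, div_lt_iff₀ hsk]
      exact mul_lt_mul_of_pos_left hCk hwk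
    simpa using this.trans_le (hwW k hk)
  · have hsub : S.erase k ⊆ S := S.erase_subset k
    obtain ⟨T, hTS, hTC, B, hB, hy⟩ := ih (S.erase k) (Finset.erase_ssubset hk)
      (fun j hj => hs j (hsub hj)) (fun j hj => hw j (hsub hj)) (fun j hj => hwW j (hsub hj))
      (sub_nonneg.2 hCk)
    have hkT : k ∉ T := fun h => Finset.notMem_erase k S (hTS h)
    refine ⟨insert k T, Finset.insert_subset hk (hTS.trans hsub), ?_, w k + B, ?_, ?_⟩
    · rw [Finset.sum_insert hkT]; linarith
    · rw [Finset.sum_insert hkT]; linarith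
    · intro y hy0 hy1 hyC
      rw [← Finset.add_sum_erase _ _ hk] at hyC ⊢
      set A := ∑ j ∈ S.erase k, s j * y j with hA
      -- Raising `y k` to `1` takes room from the other items, which are shrunk by `θ`. The size
      -- given up is at most `s k * (1 - y k)`, and since `k` is densest, the weight given up is at
      -- most the gain `w k * (1 - y k)`.
      obtain ⟨θ, hθ0, hθ1, hθA, hθk⟩ : ∃ θ : ℝ, 0 ≤ θ ∧ θ ≤ 1 ∧ θ * A ≤ C - s k ∧
          (1 - θ) * A ≤ s k * (1 - y k) := by
        rcases le_or_gt A (C - s k) with h | h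
        · exact ⟨1, zero_le_one, le_rfl, by simpa,
            by simpa using mul_nonneg hsk.le (sub_nonneg.2 (hy1 k hk))⟩
        · have hA0 : 0 < A := (sub_nonneg.2 hCk).trans_lt h
          refine ⟨(C - s k) / A, div_nonneg (sub_nonneg.2 hCk) hA0.le,
            (div_le_one hA0).2 h.le, (div_mul_cancel₀ _ hA0.ne').le, ?_⟩
          rw [sub_mul, div_mul_cancel₀ _ hA0.ne']
          linarith
      have h1 := hy (fun j => θ * y j) (fun j hj => mul_nonneg hθ0 (hy0 j (hsub hj)))
        (fun j hj => mul_le_one₀ hθ1 (hy0 j (hsub hj)) (hy1 j (hsub hj)))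
        (by simpa [mul_left_comm, ← Finset.mul_sum] using hθA)
      have h2 : ∑ j ∈ S.erase k, w j * (θ * y j) = θ * ∑ j ∈ S.erase k, w j * y j := by
        rw [Finset.mul_sum]
        exact Finset.sum_congr rfl fun j _ => by ring
      rw [h2] at h1
      have h3 := mul_le_mul_of_nonneg_left (hbd _ hsub y hy0) (sub_nonneg.2 hθ1)
      have h4 := mul_le_mul_of_nonneg_left hθk hdens0
      have h5 : w k / s k * (s k * (1 - y k)) = w k * (1 - y k) := by
        field_simp
      rw [h5] at h4
      rw [← hA] at h3
      linarith

lemma IsFeasible.nonneg {τ : ℕ} {p : Channels N M} {x : Fin N → Fin M → ℝ}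
    (hx : IsFeasible τ p x) (i : Fin N) (j : Fin M) : 0 ≤ x i j := by
  rcases hx.zero_or_one i j with h | h <;> simp [h]

lemma IsFeasible.le_weightedDet {τ : ℕ} {p : Channels N M} {w : Fin M → ℝ} (hw : ∀ j, 0 ≤ w j)
    {x : Fin N → Fin M → ℝ} (hx : IsFeasible τ p x) :
    ∑ i, ∑ j, x i j * w j ≤ weightedDet τ p w := by
  refine le_csSup ⟨∑ _i : Fin N, ∑ j, w j, ?_⟩ ⟨x, hx, rfl⟩
  rintro _ ⟨x, hx, rfl⟩
  refine Finset.sum_le_sum fun i _ => Finset.sum_le_sum fun j _ => ?_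
  rcases hx.zero_or_one i j with h | h <;> simp [h, hw j]

lemma isFeasible_zero (τ : ℕ) (p : Channels N M) : IsFeasible τ p 0 where
  zero_or_one := by simp
  no_link := by simp
  capacity := by simp
  at_most_one_bin := by simp

lemma weightedDet_nonneg (τ : ℕ) (p : Channels N M) {w : Fin M → ℝ} (hw : ∀ j, 0 ≤ w j) :
    0 ≤ weightedDet τ p w := by
  simpa using (isFeasible_zero τ p).le_weightedDet hw

/-- For a fixed assignment the access points face separate knapsack problems. Their integral
packings lie in disjoint fibres of `a`, so together they are feasible for the relaxed problem. -/
lemma exists_assignment_bound {τ : ℕ} (hN : 0 < N) (p : Channels N M) {w : Fin M → ℝ} {W : ℝ}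
    (hW : 0 < W) (hw : ∀ j, 0 < w j) (hwW : ∀ j, w j ≤ W) (a : Fin M → Fin N) :
    ∃ B < weightedDet τ p w + N * W, ∀ U : Fin M → ℝ, (∀ j, 0 ≤ U j) →
      (∀ j, p (a j) j * U j ≤ 1) → (∀ i, ∑ j with a j = i, U j ≤ τ) →
      ∑ j, w j * (p (a j) j * U j) ≤ B := by
  have hp : ∀ i j, (0 : ℝ) ≤ p i j := fun i j => (p i j).2.1
  choose T hTS hTC B hB hy using fun i : Fin N =>
    exists_knapsack_packing (s := fun j => (p i j : ℝ)⁻¹) (w := w) hW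
      (Finset.univ.filter fun j => a j = i ∧ (p i j : ℝ) ≠ 0)
      (fun j hj => inv_pos.2 ((hp i j).lt_of_ne' (Finset.mem_filter.1 hj).2.2))
      (fun j _ => hw j) (fun j _ => hwW j) (Nat.cast_nonneg (α := ℝ) τ)
  have hmem : ∀ {i j}, j ∈ T i → a j = i ∧ (p i j : ℝ) ≠ 0 := fun hj =>
    (Finset.mem_filter.1 (hTS _ hj)).2
  have hx : IsFeasible τ p fun i j => if j ∈ T i then 1 else 0 := by
    refine ⟨fun i j => ?_, fun i j h0 => ?_, fun i => ?_, fun j => ?_⟩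
    · split_ifs <;> simp
    · rw [if_neg fun hj => (hmem hj).2 h0]
    · have := hTC i
      simpa [ite_div, Finset.sum_ite_mem] using this
    · calc ∑ i, (if j ∈ T i then (1 : ℝ) else 0) ≤ ∑ i, if i = a j then 1 else 0 := by
            refine Finset.sum_le_sum fun i _ => ?_
            by_cases hj : j ∈ T i
            · simp [hj, (hmem hj).1]
            · simp only [hj, if_false]
              split_ifs <;> norm_num
        _ = 1 := by simp
  have hdet := hx.le_weightedDet (w := w) fun j => (hw j).le
  simp only [ite_mul, one_mul, zero_mul, Finset.sum_ite_mem, Finset.univ_inter] at hdet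
  refine ⟨∑ i, B i, ?_, fun U hU0 hU1 hUτ => ?_⟩
  · have hne : (Finset.univ : Finset (Fin N)).Nonempty := ⟨⟨0, hN⟩, Finset.mem_univ _⟩
    calc ∑ i, B i < ∑ i, (∑ j ∈ T i, w j + W) := Finset.sum_lt_sum_of_nonempty hne fun i _ => hB i
      _ = ∑ i, ∑ j ∈ T i, w j + N * W := by simp [Finset.sum_add_distrib]
      _ ≤ _ := by linarith
  · rw [← Finset.sum_fiberwise Finset.univ a]
    refine Finset.sum_le_sum fun i _ => ?_
    have h1 := hy i (fun j => p (a j) j * U j) (fun j _ => mul_nonneg (hp _ _) (hU0 j))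
      (fun j _ => hU1 j) <| by
        calc ∑ j with a j = i ∧ (p i j : ℝ) ≠ 0, (p i j : ℝ)⁻¹ * (p (a j) j * U j)
            = ∑ j with a j = i ∧ (p i j : ℝ) ≠ 0, U j := by
              refine Finset.sum_congr rfl fun j hj => ?_
              obtain ⟨rfl, h0⟩ := (Finset.mem_filter.1 hj).2
              rw [inv_mul_cancel_left₀ h0]
          _ ≤ ∑ j with a j = i, U j :=
              Finset.sum_le_sum_of_subset_of_nonneg
                (Finset.monotone_filter_right _ fun j _ h => h.1) fun j _ _ => hU0 j
          _ ≤ τ := hUτ i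
    -- Clients without a link were left out of the knapsack; they contribute nothing.
    refine le_trans (le_of_eq ?_) h1
    symm
    refine Finset.sum_subset (Finset.monotone_filter_right _ fun j _ h => h.1) fun j hj hj' => ?_
    obtain rfl : a j = i := by simpa using hj
    have h0 : (p (a j) j : ℝ) = 0 := by simpa using hj'
    rw [h0]; ring

/-- In each interval, whatever happened before, the expected weighted number of deliveries of any
policy is less than the value of the relaxed problem plus one maximal weight per access point. -/
lemma exists_interval_bound {τ : ℕ} (hN : 0 < N) (p : Channels N M) {w : Fin M → ℝ} {W : ℝ}
    (hW : 0 < W) (hw : ∀ j, 0 < w j) (hwW : ∀ j, w j ≤ W) :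
    ∃ B, 0 ≤ B ∧ B < weightedDet τ p w + N * W ∧ ∀ (η : Policy N M) (h : History N M),
      ∫ c, ∑ j, w j * (if j ∈ (runSlots η (beginInterval η h) (fun s i j => c (s, i, j)) τ).pending
        then (0 : ℝ) else 1) ∂(channelLaw p) ≤ B := by
  choose B hB hBU using exists_assignment_bound (τ := τ) hN p hW hw hwW
  have : Nonempty (Fin N) := ⟨⟨0, hN⟩⟩
  -- The worst of the finitely many assignments gives a bound independent of policy and history, so
  -- the strict inequality survives the supremum over policies.
  obtain ⟨a₀, ha₀⟩ := Finite.exists_max B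
  refine ⟨B a₀, ?_, hB a₀, fun η h => ?_⟩
  · simpa using hBU a₀ 0 (by simp) (by simp) (by simp)
  · obtain ⟨U, hU0, hU, hUτ⟩ := exists_airtime p η h τ
    have hint : ∀ j, Integrable (fun c : Outcomes N M =>
        if j ∈ (runSlots η (beginInterval η h) (fun s i j => c (s, i, j)) τ).pending
        then (0 : ℝ) else 1) (channelLaw p) := fun j =>
      DependsOn.integrable (m := τ) (fun c d hcd => by
        have := dependsOn_runSlots η (beginInterval η h) τ hcd
        simp only at this
        simp only [this]) _
    rw [integral_finsetSum _ fun j _ => (hint j).const_mul _]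
    simp_rw [integral_const_mul, hU]
    refine (hBU _ U hU0 (fun j => ?_) hUτ).trans (ha₀ _)
    rw [← hU]
    calc _ ≤ ∫ _, (1 : ℝ) ∂(channelLaw p) := by
          refine integral_mono (hint j) (integrable_const _) fun c => ?_
          simp only
          split_ifs <;> norm_num
      _ = 1 := by simp

/-! ### Upper limits that hold almost surely -/

section AlmostSureLimsup

variable {P : Measure (Outcomes N M)} {a : Outcomes N M → ℕ → ℝ} {C : ℝ}

/-- One outcome at which both almost sure events hold suffices. `0 ≤ B` covers the default value
`sSup ∅ = 0`. -/
lemma almostSureLimsup_le [IsProbabilityMeasure P] (h0 : ∀ c r, 0 ≤ a c r) {B : ℝ} (hB : 0 ≤ B)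
    (h : ∀ ε > 0, ∀ᵐ c ∂P, ∀ᶠ r in atTop, a c r ≤ B + ε) : almostSureLimsup P a ≤ B := by
  refine Real.sSup_le (fun R hR => ?_) hB
  refine le_of_forall_pos_le_add fun ε hε => ?_
  obtain ⟨c, hc, hcR⟩ := ((h ε hε).and hR).exists
  refine hcR.trans (limsup_le_of_le ?_ hc)
  exact (isBoundedUnder_of ⟨0, fun r => h0 c r⟩ :
    IsBoundedUnder (· ≥ ·) atTop (a c)).isCoboundedUnder_le

lemma bddAbove_almostSureLimsup [IsProbabilityMeasure P] (h0 : ∀ c r, 0 ≤ a c r) (hC : ∀ c r, a c r ≤ C) :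
    BddAbove {R : ℝ | ∀ᵐ c ∂P, R ≤ limsup (a c) atTop} := by
  refine ⟨C, fun R hR => ?_⟩
  obtain ⟨c, hc⟩ := Eventually.exists (show ∀ᵐ c ∂P, R ≤ limsup (a c) atTop from hR)
  refine hc.trans (limsup_le_of_le ?_ (Eventually.of_forall (hC c)))
  exact (isBoundedUnder_of ⟨0, fun r => h0 c r⟩ :
    IsBoundedUnder (· ≥ ·) atTop (a c)).isCoboundedUnder_le

lemma le_almostSureLimsup [IsProbabilityMeasure P] (h0 : ∀ c r, 0 ≤ a c r) (hC : ∀ c r, a c r ≤ C) {R : ℝ}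
    (hR : ∀ᵐ c ∂P, R ≤ limsup (a c) atTop) : R ≤ almostSureLimsup P a :=
  le_csSup (bddAbove_almostSureLimsup h0 hC) hR

lemma ae_le_limsup_of_lt_almostSureLimsup (h0 : ∀ c r, 0 ≤ a c r) (hC : ∀ c r, a c r ≤ C) {R : ℝ}
    (hR : R < almostSureLimsup P a) : ∀ᵐ c ∂P, R ≤ limsup (a c) atTop := by
  have hne : {R : ℝ | ∀ᵐ c ∂P, R ≤ limsup (a c) atTop}.Nonempty :=
    ⟨0, ae_of_all _ fun c => le_limsup_of_frequently_le
      (Eventually.of_forall (h0 c)).frequently (isBoundedUnder_of ⟨C, fun r => hC c r⟩)⟩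
  obtain ⟨R', hR', hlt⟩ := exists_lt_of_lt_csSup hne hR
  filter_upwards [hR'] with c hc
  exact hlt.le.trans hc

end AlmostSureLimsup

/-! ### Averages over intervals -/

lemma delivered_nonneg (τ : ℕ) (η : Policy N M) (c : Outcomes N M) (k : ℕ) (j : Fin M) :
    0 ≤ delivered τ η c k j := by
  unfold delivered; split_ifs <;> norm_num

lemma delivered_le_one (τ : ℕ) (η : Policy N M) (c : Outcomes N M) (k : ℕ) (j : Fin M) :
    delivered τ η c k j ≤ 1 := by
  unfold delivered; split_ifs <;> norm_num

lemma clientAverage_nonneg (τ : ℕ) (η : Policy N M) (j : Fin M) (c : Outcomes N M) (r : ℕ) :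
    0 ≤ clientAverage τ η j c r :=
  div_nonneg (Finset.sum_nonneg fun _ _ => delivered_nonneg _ _ _ _ _) (Nat.cast_nonneg _)

lemma clientAverage_le_one (τ : ℕ) (η : Policy N M) (j : Fin M) (c : Outcomes N M) (r : ℕ) :
    clientAverage τ η j c r ≤ 1 :=
  div_le_one_of_le₀ ((Finset.sum_le_sum fun _ _ => delivered_le_one _ _ _ _ _).trans (by simp))
    (Nat.cast_nonneg _)

lemma weightedAverage_eq (τ : ℕ) (w : Fin M → ℝ) (η : Policy N M) (c : Outcomes N M) (r : ℕ) :
    weightedAverage τ w η c r = ∑ j, w j * clientAverage τ η j c r := by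
  unfold weightedAverage clientAverage
  rw [Finset.sum_comm, Finset.sum_div]
  simp_rw [← Finset.mul_sum, mul_div_assoc]

lemma weightedAverage_nonneg (τ : ℕ) {w : Fin M → ℝ} (hw : ∀ j, 0 ≤ w j) (η : Policy N M)
    (c : Outcomes N M) (r : ℕ) : 0 ≤ weightedAverage τ w η c r := by
  rw [weightedAverage_eq]
  exact Finset.sum_nonneg fun j _ => mul_nonneg (hw j) (clientAverage_nonneg _ _ _ _ _)

lemma weightedAverage_le (τ : ℕ) {w : Fin M → ℝ} (hw : ∀ j, 0 ≤ w j) (η : Policy N M)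
    (c : Outcomes N M) (r : ℕ) : weightedAverage τ w η c r ≤ ∑ j, w j := by
  rw [weightedAverage_eq]
  exact Finset.sum_le_sum fun j _ =>
    mul_le_of_le_one_right (hw j) (clientAverage_le_one _ _ _ _ _)

/-- The weighted throughput of any policy is bounded by a uniform bound on the conditional
expectations of the weighted number of deliveries in an interval. -/
lemma weightedThroughput_le {τ : ℕ} (p : Channels N M) {w : Fin M → ℝ} (hw : ∀ j, 0 ≤ w j)
    (η : Policy N M) {B : ℝ} (hB0 : 0 ≤ B)
    (hB : ∀ h : History N M, ∫ c, ∑ j, w j *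
      (if j ∈ (runSlots η (beginInterval η h) (fun s i j => c (s, i, j)) τ).pending
        then (0 : ℝ) else 1) ∂(channelLaw p) ≤ B) :
    weightedThroughput τ p w η ≤ B := by
  refine almostSureLimsup_le (weightedAverage_nonneg τ hw η) hB0 fun ε hε => ?_
  set R : History N M → Outcomes N M → ℝ := fun h c => ∑ j, w j *
      (if j ∈ (runSlots η (beginInterval η h) (fun s i j => c (s, i, j)) τ).pending
        then (0 : ℝ) else 1) with hR
  have hRdep : ∀ h, DependsOn (R h) (slotsBefore N M τ) := fun h c d hcd => by
    have := dependsOn_runSlots η (beginInterval η h) τ hcd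
    simp only at this
    simp only [hR, this]
  have hR0 : ∀ h c, 0 ≤ R h c := fun h c => Finset.sum_nonneg fun j _ =>
    mul_nonneg (hw j) (by split_ifs <;> norm_num)
  have hR1 : ∀ h c, R h c ≤ ∑ j, w j := fun h c => Finset.sum_le_sum fun j _ =>
    mul_le_of_le_one_right (hw j) (by split_ifs <;> norm_num)
  have hw0 : 0 ≤ ∑ j, w j := Finset.sum_nonneg fun j _ => hw j
  -- The reward is centred by `B`, not by its conditional mean; the `+ 1` in `K` only ensures `0 <
  -- K`.
  have key := ae_eventually_sum_rewards_le (τ := τ) p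
    (g := fun k c d => R (historyBefore τ η c k) d - B)
    (fun k d c c' h => by
      have := dependsOn_historyBefore τ η k h
      simp only at this
      simp only [this])
    (fun k c d d' h => by simp only [hRdep _ h])
    (K := ∑ j, w j + B + 1) (by linarith)
    (fun k c d => abs_le.2 ⟨by linarith [hR0 (historyBefore τ η c k) d],
      by linarith [hR1 (historyBefore τ η c k) d]⟩)
    (fun k c => by
      rw [integral_sub (DependsOn.integrable (hRdep _) _) (integrable_const _)]
      simpa only [integral_const, probReal_univ, one_smul, sub_nonpos] using hB _) hε
  filter_upwards [key] with c hc
  filter_upwards [hc, eventually_gt_atTop 0] with r hr hr0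
  have hr0' : (0 : ℝ) < r := Nat.cast_pos.2 hr0
  unfold weightedAverage
  rw [div_le_iff₀ hr0']
  have h1 : ∑ k ∈ Finset.range r, ∑ j, w j * delivered τ η c k j =
      ∑ k ∈ Finset.range r, R (historyBefore τ η c k) (shift (k * τ) c) := rfl
  rw [Finset.sum_sub_distrib] at hr
  simp only [Finset.sum_const, Finset.card_range, nsmul_eq_mul] at hr
  rw [h1]
  linarith

/-- If the long-term averages of all clients exist, then the weighted sum of the timely throughputs
is at most the weighted throughput. -/
lemma sum_timelyThroughput_le_weightedThroughput {τ : ℕ} (p : Channels N M) {w : Fin M → ℝ}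
    (hw : ∀ j, 0 ≤ w j) {η : Policy N M} (hη : HasLongTermAverages τ p η) :
    ∑ j, w j * timelyThroughput τ p η j ≤ weightedThroughput τ p w η := by
  have hw0 : 0 ≤ ∑ j, w j := Finset.sum_nonneg fun j _ => hw j
  refine le_of_forall_pos_le_add fun ε hε => ?_
  have hδ : 0 < ε / (∑ j, w j + 1) := by positivity
  set δ := ε / (∑ j, w j + 1) with hδdef
  have hlow : ∀ j, ∀ᵐ c ∂(channelLaw p),
      timelyThroughput τ p η j - δ ≤ limsup (clientAverage τ η j c) atTop := fun j =>
    ae_le_limsup_of_lt_almostSureLimsup (clientAverage_nonneg τ η j) (clientAverage_le_one τ η j)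
      (sub_lt_self _ hδ)
  have hmem : ∑ j, w j * (timelyThroughput τ p η j - δ) ≤ weightedThroughput τ p w η := by
    refine le_almostSureLimsup (weightedAverage_nonneg τ hw η) (weightedAverage_le τ hw η) ?_
    filter_upwards [ae_all_iff.2 hlow, ae_all_iff.2 hη] with c hc hlim
    choose R hR using hlim
    -- Upper limits are only subadditive, the wrong direction here; the existence of limits gives
    -- additivity.
    have hlimw : Tendsto (weightedAverage τ w η c) atTop (𝓝 (∑ j, w j * R j)) := by
      have : weightedAverage τ w η c = fun r => ∑ j, w j * clientAverage τ η j c r :=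
        funext fun r => weightedAverage_eq τ w η c r
      rw [this]
      exact tendsto_finsetSum _ fun j _ => (hR j).const_mul _
    rw [hlimw.limsup_eq]
    refine Finset.sum_le_sum fun j _ => mul_le_mul_of_nonneg_left ?_ (hw j)
    simpa [(hR j).limsup_eq] using hc j
  simp_rw [mul_sub] at hmem
  rw [Finset.sum_sub_distrib, ← Finset.sum_mul] at hmem
  have : (∑ j, w j) * δ ≤ ε := by
    rw [hδdef, ← mul_div_assoc, div_le_iff₀ (by linarith)]
    nlinarith
  linarith

/-! ### Policies that serve the best channel first -/

/-- The client of `D` with the best channel from access point `i`. -/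
def best (p : Channels N M) (i : Fin N) (D : Finset (Fin M)) : Option (Fin M) :=
  if h : D.Nonempty then some (D.exists_max_image (fun j => (p i j : ℝ)) h).choose else none

lemma best_eq_some {p : Channels N M} {i : Fin N} {D : Finset (Fin M)} {j : Fin M}
    (h : best p i D = some j) : j ∈ D ∧ ∀ k ∈ D, (p i k : ℝ) ≤ p i j := by
  unfold best at h
  split_ifs at h with hD
  cases h
  exact (D.exists_max_image (fun j => (p i j : ℝ)) hD).choose_spec

lemma best_eq_none {p : Channels N M} {i : Fin N} {D : Finset (Fin M)} (h : best p i D = none) :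
    D = ∅ := by
  unfold best at h
  split_ifs at h with hD
  exact Finset.not_nonempty_iff_eq_empty.1 hD

/-- The packets that remain of `Q` after a slot in which each access point `i` serves the best
channel among its targets `T i`. -/
def serve (p : Channels N M) (T : Fin N → Finset (Fin M)) (Q : Finset (Fin M))
    (a : Fin N → Fin M → Bool) : Finset (Fin M) :=
  Q.filter fun j => ∀ i, ¬ (best p i (T i ∩ Q) = some j ∧ a i j = true)

/-- The packets that remain after `n` slots of an interval. -/
def remaining (p : Channels N M) (T : Fin N → Finset (Fin M)) (c : ℕ → Fin N → Fin M → Bool) :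
    ℕ → Finset (Fin M)
  | 0 => Finset.univ
  | n + 1 => serve p T (remaining p T c n) (c n)

/-- The packets that have not been delivered in any of the recorded slots. -/
def undelivered (l : History N M) : Finset (Fin M) :=
  Finset.univ.filter fun j => ∀ r ∈ l, ∀ i, r i ≠ some (j, true)

/-- Each client `j` is assigned to the access point `home j`, and the access points serve their
best channels first, among their targets. -/
def bestFirst (τ : ℕ) (p : Channels N M) (T : Fin N → Finset (Fin M)) (home : Fin M → Fin N) :
    Policy N M where
  assign _ := home
  -- `h.length % τ` slots of the current interval have passed, and their records come first in `h`.
  transmit h i := best p i (T i ∩ undelivered (h.take (h.length % τ)))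

lemma length_history_runSlots (η : Policy N M) (s₀ : State N M)
    (c : ℕ → Fin N → Fin M → Bool) (n : ℕ) :
    (runSlots η s₀ c n).history.length = s₀.history.length + n := by
  induction n with
  | zero => rfl
  | succ n ih => simp [runSlots, slotStep, ih, add_assoc]

lemma length_historyBefore (τ : ℕ) (η : Policy N M) (c : Outcomes N M) (k : ℕ) :
    (historyBefore τ η c k).length = k * τ := by
  induction k with
  | zero => simp [historyBefore]
  | succ k ih => simp [historyBefore, length_history_runSlots, beginInterval, ih, add_mul]

section BestFirst

variable {τ : ℕ} {p : Channels N M} {T : Fin N → Finset (Fin M)} {home : Fin M → Fin N}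

/-- The policy sees only the history; because `τ` divides the length of the earlier part, it
recovers exactly the current records, and from them the pending packets. -/
lemma runSlots_bestFirst (hT : ∀ i, ∀ j ∈ T i, home j = i) {h : History N M}
    (hh : τ ∣ h.length) (c : ℕ → Fin N → Fin M → Bool) {n : ℕ} (hn : n ≤ τ) :
    ∃ l : History N M,
      (runSlots (bestFirst τ p T home) (beginInterval (bestFirst τ p T home) h) c n).history =
        l ++ h ∧ l.length = n ∧
      (runSlots (bestFirst τ p T home) (beginInterval (bestFirst τ p T home) h) c n).pending =
        undelivered l ∧ undelivered l = remaining p T c n := by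
  induction n with
  | zero => exact ⟨[], by simp [runSlots, beginInterval, undelivered, remaining]⟩
  | succ n ih =>
    obtain ⟨l, hl, hln, hlu, hlr⟩ := ih (Nat.le_of_succ_le hn)
    have ha := assignment_runSlots (bestFirst τ p T home)
      (beginInterval (bestFirst τ p T home) h) c n
    set s := runSlots (bestFirst τ p T home) (beginInterval (bestFirst τ p T home) h) c n
    have hsent : ∀ i, sent (bestFirst τ p T home) s i = best p i (T i ∩ undelivered l) := by
      intro i
      have htake : s.history.take (s.history.length % τ) = l := by
        obtain ⟨q, hq⟩ := hh
        rw [hl, List.length_append, hln, hq, Nat.add_mul_mod_self_left,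
          Nat.mod_eq_of_lt hn, ← hln, List.take_left]
      have htr : (bestFirst τ p T home).transmit s.history i =
          best p i (T i ∩ undelivered l) := by
        simp only [bestFirst, htake]
      unfold sent
      rw [htr]
      cases hb : best p i (T i ∩ undelivered l) with
      | none => rfl
      | some j =>
        have hj := Finset.mem_inter.1 (best_eq_some hb).1
        rw [Option.filter_some, if_pos]
        simpa [ha, beginInterval, bestFirst, hT i j hj.1, hlu] using hj.2
    have hrec : ∀ i j, slotRecord (bestFirst τ p T home) s (c n) i = some (j, true) ↔
        best p i (T i ∩ undelivered l) = some j ∧ c n i j = true := by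
      intro i j
      rw [slotRecord_eq_some_true, hsent]
    refine ⟨slotRecord (bestFirst τ p T home) s (c n) :: l, ?_, by simp [hln], ?_, ?_⟩
    · simp [runSlots, slotStep, s, hl]
    · change s.pending.filter _ = _
      rw [hlu]
      ext j
      simp only [undelivered, Finset.mem_filter, Finset.mem_univ, true_and, List.mem_cons,
        forall_eq_or_imp]
      exact and_comm
    · ext j
      simp only [remaining, serve, ← hlr, Finset.mem_filter, ← hrec]
      simp only [undelivered, Finset.mem_filter, Finset.mem_univ, true_and, List.mem_cons,
        forall_eq_or_imp]
      exact and_comm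

lemma pending_bestFirst (hT : ∀ i, ∀ j ∈ T i, home j = i) (c : Outcomes N M) (k : ℕ) :
    (endOfInterval τ (bestFirst τ p T home) c k).pending =
      remaining p T (fun s i j => shift (k * τ) c (s, i, j)) τ := by
  have hdvd : τ ∣ (historyBefore τ (bestFirst τ p T home) c k).length := by
    simp [length_historyBefore]
  obtain ⟨l, -, -, h1, h2⟩ := runSlots_bestFirst hT hdvd
    (fun s i j => shift (k * τ) c (s, i, j)) le_rfl
  exact h1.trans h2

lemma dependsOn_remaining (p : Channels N M) (T : Fin N → Finset (Fin M)) (n : ℕ) :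
    DependsOn (fun c : Outcomes N M => remaining p T (fun s i j => c (s, i, j)) n)
      (slotsBefore N M n) := by
  induction n with
  | zero => exact fun _ _ _ => rfl
  | succ n ih =>
    intro c d h
    have h1 := ih (x := c) (y := d) fun x hx => h x (Nat.lt_succ_of_lt hx)
    have h2 : (fun i j => c (n, i, j)) = fun i j => d (n, i, j) := by
      funext i j
      exact h (n, i, j) (Nat.lt_succ_self n)
    simp only at h1
    simp only [remaining, h1, h2]

lemma integrable_remaining (p : Channels N M) (T : Fin N → Finset (Fin M)) (n : ℕ)
    (f : Finset (Fin M) → ℝ) :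
    Integrable (fun c : Outcomes N M => f (remaining p T (fun s i j => c (s, i, j)) n))
      (channelLaw p) :=
  DependsOn.integrable (m := n) (fun c d h => by
    have := dependsOn_remaining p T n h
    simp only at this
    simp only [this]) _

/-- The probability that the packet of client `j` is delivered in an interval. -/
def deliveryProb (τ : ℕ) (p : Channels N M) (T : Fin N → Finset (Fin M)) (j : Fin M) : ℝ :=
  ∫ c, (if j ∈ remaining p T (fun s i j => c (s, i, j)) τ then (0 : ℝ) else 1) ∂(channelLaw p)

/-- The policy ignores earlier intervals, so each delivery is the same function of the shifted
channels; the one-sided law of large numbers is applied to `f - q` and to `q - f`. -/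
lemma tendsto_clientAverage_bestFirst (hT : ∀ i, ∀ j ∈ T i, home j = i) (j : Fin M) :
    ∀ᵐ c ∂(channelLaw p), Tendsto (clientAverage τ (bestFirst τ p T home) j c) atTop
      (𝓝 (deliveryProb τ p T j)) := by
  set f : Outcomes N M → ℝ :=
    fun c => if j ∈ remaining p T (fun s i j => c (s, i, j)) τ then (0 : ℝ) else 1 with hf
  have hfdep : DependsOn f (slotsBefore N M τ) := fun c d h => by
    have := dependsOn_remaining p T τ h
    simp only at this
    simp only [hf, this]
  have hfint : Integrable f (channelLaw p) := DependsOn.integrable hfdep _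
  have hf0 : ∀ c, 0 ≤ f c := fun c => by simp only [hf]; split_ifs <;> norm_num
  have hf1 : ∀ c, f c ≤ 1 := fun c => by simp only [hf]; split_ifs <;> norm_num
  set q := deliveryProb τ p T j with hq
  have hqf : ∫ c, f c ∂(channelLaw p) = q := rfl
  have hq0 : 0 ≤ q := hqf ▸ integral_nonneg hf0
  have hq1 : q ≤ 1 := by
    rw [← hqf]
    exact (integral_mono hfint (integrable_const 1) hf1).trans (by simp)
  have hdel : ∀ c k, delivered τ (bestFirst τ p T home) c k j = f (shift (k * τ) c) := by
    intro c k
    simp only [delivered, pending_bestFirst hT, hf]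
  -- The tolerances `1 / (n + 1)` keep the intersection of almost sure events countable.
  have hup : ∀ n : ℕ, ∀ᵐ c ∂(channelLaw p), ∀ᶠ r : ℕ in atTop,
      ∑ k ∈ Finset.range r, (f (shift (k * τ) c) - q) ≤ 1 / ((n : ℝ) + 1) * r := fun n =>
    ae_eventually_sum_rewards_le p (τ := τ) (g := fun _ _ d => f d - q) (fun _ _ _ _ _ => rfl)
      (fun _ _ c d h => by simp only [hfdep h]) one_pos
      (fun _ _ d => abs_le.2 ⟨by linarith [hf0 d], by linarith [hf1 d]⟩)
      (fun _ _ => by rw [integral_sub hfint (integrable_const _)]; simp [hqf])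
      Nat.one_div_pos_of_nat
  have hlow : ∀ n : ℕ, ∀ᵐ c ∂(channelLaw p), ∀ᶠ r : ℕ in atTop,
      ∑ k ∈ Finset.range r, (q - f (shift (k * τ) c)) ≤ 1 / ((n : ℝ) + 1) * r := fun n =>
    ae_eventually_sum_rewards_le p (τ := τ) (g := fun _ _ d => q - f d) (fun _ _ _ _ _ => rfl)
      (fun _ _ c d h => by simp only [hfdep h]) one_pos
      (fun _ _ d => abs_le.2 ⟨by linarith [hf1 d], by linarith [hf0 d]⟩)
      (fun _ _ => by rw [integral_sub (integrable_const _) hfint]; simp [hqf])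
      Nat.one_div_pos_of_nat
  filter_upwards [ae_all_iff.2 hup, ae_all_iff.2 hlow] with c hcu hcl
  rw [Metric.tendsto_atTop']
  intro ε hε
  obtain ⟨n, hn⟩ := exists_nat_one_div_lt hε
  obtain ⟨r₀, hr₀⟩ := eventually_atTop.1 ((hcu n).and (hcl n))
  refine ⟨r₀, fun r hr => ?_⟩
  obtain ⟨h1, h2⟩ := hr₀ r hr.le
  have hr0 : (0 : ℝ) < r := Nat.cast_pos.2 (Nat.zero_lt_of_lt hr)
  rw [Finset.sum_sub_distrib] at h1 h2
  simp only [Finset.sum_const, Finset.card_range, nsmul_eq_mul] at h1 h2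
  have hcr : clientAverage τ (bestFirst τ p T home) j c r - q =
      (∑ k ∈ Finset.range r, f (shift (k * τ) c) - r * q) / r := by
    simp only [clientAverage, hdel]
    field_simp
  rw [Real.dist_eq, hcr, abs_div, abs_of_pos hr0, div_lt_iff₀ hr0]
  refine lt_of_le_of_lt (abs_le.2 ⟨?_, h1⟩) (mul_lt_mul_of_pos_right hn hr0)
  linarith

lemma hasLongTermAverages_bestFirst (hT : ∀ i, ∀ j ∈ T i, home j = i) :
    HasLongTermAverages τ p (bestFirst τ p T home) := fun j => by
  filter_upwards [tendsto_clientAverage_bestFirst (τ := τ) (p := p) hT j] with c hc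
  exact ⟨_, hc⟩

lemma deliveryProb_le_timelyThroughput (hT : ∀ i, ∀ j ∈ T i, home j = i) (j : Fin M) :
    deliveryProb τ p T j ≤ timelyThroughput τ p (bestFirst τ p T home) j := by
  refine le_almostSureLimsup (clientAverage_nonneg τ _ j) (clientAverage_le_one τ _ j) ?_
  filter_upwards [tendsto_clientAverage_bestFirst (τ := τ) (p := p) hT j] with c hc
  exact hc.limsup_eq.ge

/-! ### The expected number of packets that remain undelivered -/

/-- The rate at which access point `i` delivers packets while `D` is its set of remaining targets. -/
def rate (p : Channels N M) (i : Fin N) (D : Finset (Fin M)) : ℝ :=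
  (best p i D).elim 0 fun j => p i j

lemma rate_nonneg (p : Channels N M) (i : Fin N) (D : Finset (Fin M)) : 0 ≤ rate p i D := by
  unfold rate
  cases best p i D with
  | none => exact le_rfl
  | some j => exact (p i j).2.1

lemma le_rate {i : Fin N} {D : Finset (Fin M)} {j : Fin M} (hj : j ∈ D) :
    (p i j : ℝ) ≤ rate p i D := by
  unfold rate
  cases hb : best p i D with
  | none => simp [best_eq_none hb] at hj
  | some k => exact (best_eq_some hb).2 j hj

lemma rate_mono {i : Fin N} {D D' : Finset (Fin M)} (h : D' ⊆ D) : rate p i D' ≤ rate p i D := by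
  cases hb : best p i D' with
  | none => simpa [rate, hb] using rate_nonneg p i D
  | some k => simpa [rate, hb] using le_rate (p := p) (h (best_eq_some hb).1)

/-- A supermartingale that controls the number of remaining packets: `D` is the set of remaining
targets among all targets `A` of access point `i` after `n` slots, and the delay compared with the
expected delivery times of the delivered packets is measured relative to the current rate. -/
def potential (p : Channels N M) (i : Fin N) (A : Finset (Fin M)) (n : ℕ) (D : Finset (Fin M)) :
    ℝ :=
  (rate p i D * (n - ∑ j ∈ A \ D, (p i j : ℝ)⁻¹)) ^ 2 + D.card

/-- At the fixed rate `p i j` the scaled delay moves by `p i j - 1` on success and by `p i j` on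
failure: mean zero, variance `p i j * (1 - p i j)`. The expected drop `p i j` of `D.card` pays for
the variance. A delivery cannot raise the rate, because the best channel is served first, so
updating the rate only shrinks the square. -/
lemma potential_step {i : Fin N} {A D : Finset (Fin M)} (hDA : D ⊆ A)
    (hA : ∀ j ∈ A, (p i j : ℝ) ≠ 0) {j : Fin M} (hj : best p i D = some j) (n : ℕ) :
    p i j * potential p i A (n + 1) (D.erase j) + (1 - p i j) * potential p i A (n + 1) D ≤
      potential p i A n D := by
  have hjD := (best_eq_some hj).1
  have hp0 : (0 : ℝ) < p i j := (p i j).2.1.lt_of_ne' (hA j (hDA hjD))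
  have hrate : rate p i D = p i j := by simp [rate, hj]
  have hrate' : rate p i (D.erase j) ≤ p i j := hrate ▸ rate_mono (D.erase_subset j)
  have hcard : ((D.erase j).card : ℝ) = D.card - 1 := by
    rw [Finset.card_erase_of_mem hjD, Nat.cast_pred (Finset.card_pos.2 ⟨j, hjD⟩)]
  have hsum : ∑ k ∈ A \ D.erase j, (p i k : ℝ)⁻¹ =
      (p i j : ℝ)⁻¹ + ∑ k ∈ A \ D, (p i k : ℝ)⁻¹ := by
    rw [Finset.sdiff_erase (hDA hjD), Finset.sum_insert (by simp [hjD])]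
  unfold potential
  rw [hsum, hcard, hrate]
  set x : ℝ := n - ∑ k ∈ A \ D, (p i k : ℝ)⁻¹ with hx
  have h1 : (((n + 1 : ℕ) : ℝ) - ((p i j : ℝ)⁻¹ + ∑ k ∈ A \ D, (p i k : ℝ)⁻¹)) =
      x + 1 - (p i j : ℝ)⁻¹ := by push_cast; ring
  have h2 : (((n + 1 : ℕ) : ℝ) - ∑ k ∈ A \ D, (p i k : ℝ)⁻¹) = x + 1 := by push_cast; ring
  rw [h1, h2]
  have h3 : (rate p i (D.erase j) * (x + 1 - (p i j : ℝ)⁻¹)) ^ 2 ≤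
      (p i j * x + p i j - 1) ^ 2 := by
    have : (p i j : ℝ) * x + p i j - 1 = p i j * (x + 1 - (p i j : ℝ)⁻¹) := by
      field_simp
    rw [this, mul_pow, mul_pow]
    exact mul_le_mul_of_nonneg_right
      (pow_le_pow_left₀ (rate_nonneg p i _) hrate' 2) (sq_nonneg _)
  have h4 := mul_le_mul_of_nonneg_left h3 hp0.le
  nlinarith [sq_nonneg (p i j : ℝ)]

/-- The target sets are disjoint through `home`, so no other access point touches the targets of
`i`. -/
lemma inter_serve (hT : ∀ i, ∀ j ∈ T i, home j = i) (Q : Finset (Fin M))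
    (a : Fin N → Fin M → Bool) (i : Fin N) {j : Fin M} (hj : best p i (T i ∩ Q) = some j) :
    T i ∩ serve p T Q a = if a i j = true then (T i ∩ Q).erase j else T i ∩ Q := by
  have hiff : ∀ k ∈ T i, (∀ i', ¬ (best p i' (T i' ∩ Q) = some k ∧ a i' k = true)) ↔
      ¬ (j = k ∧ a i k = true) := by
    intro k hk
    constructor
    · rintro h ⟨rfl, ha⟩
      exact h i ⟨hj, ha⟩
    · rintro h i' ⟨hb, ha⟩
      have hk' := (Finset.mem_inter.1 (best_eq_some hb).1).1
      obtain rfl : i = i' := (hT i k hk).symm.trans (hT i' k hk')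
      rw [hj] at hb
      exact h ⟨Option.some.inj hb, ha⟩
  ext k
  simp only [serve, Finset.mem_inter, Finset.mem_filter]
  by_cases hk : k ∈ T i
  · rw [hiff k hk]
    split_ifs with ha
    · simp only [Finset.mem_erase, Finset.mem_inter, hk, true_and]
      constructor
      · rintro ⟨h1, h2⟩
        exact ⟨fun h => h2 ⟨h.symm, h ▸ ha⟩, h1⟩
      · rintro ⟨h1, h2⟩
        exact ⟨h2, fun h => h1 h.1.symm⟩
    · simp only [Finset.mem_inter, hk, true_and, and_iff_left_iff_imp]
      rintro - ⟨rfl, h⟩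
      exact ha h
  · split_ifs <;> simp [hk]

lemma integral_potential_serve_le (hT : ∀ i, ∀ j ∈ T i, home j = i)
    (hT0 : ∀ i, ∀ j ∈ T i, (p i j : ℝ) ≠ 0) (Q : Finset (Fin M)) (i : Fin N) (n : ℕ) :
    ∫ d, potential p i (T i) (n + 1) (T i ∩ serve p T Q fun i j => d (0, i, j)) ∂(channelLaw p) ≤
      potential p i (T i) n (T i ∩ Q) := by
  cases hb : best p i (T i ∩ Q) with
  | none =>
    have h0 := best_eq_none hb
    have h1 : ∀ d : Outcomes N M, T i ∩ serve p T Q (fun i j => d (0, i, j)) = ∅ := fun d =>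
      Finset.subset_empty.1 <|
        h0 ▸ Finset.inter_subset_inter_left (Finset.filter_subset _ _)
    rw [h0] at hb
    simp [h0, h1, potential, rate, hb]
  | some j =>
    simp_rw [inter_serve hT Q _ i hb, apply_ite (potential p i (T i) (n + 1))]
    rw [integral_ite_channel_on]
    exact potential_step Finset.inter_subset_left (hT0 i) hb n

/-- Initially the delay is zero and all targets remain, so the supermartingale starts at the number
of targets. -/
lemma integral_potential_le (hT : ∀ i, ∀ j ∈ T i, home j = i)
    (hT0 : ∀ i, ∀ j ∈ T i, (p i j : ℝ) ≠ 0) (i : Fin N) (n : ℕ) :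
    ∫ c, potential p i (T i) n (T i ∩ remaining p T (fun s i j => c (s, i, j)) n)
      ∂(channelLaw p) ≤ (T i).card := by
  induction n with
  | zero => simp [remaining, potential]
  | succ n ih =>
    refine le_trans ?_ ih
    have h1 := integral_next_slot p (dependsOn_remaining p T n)
      (fun Q a => potential p i (T i) (n + 1) (T i ∩ serve p T Q a))
    refine (le_of_eq h1).trans (integral_mono_of_nonneg (ae_of_all _ fun c => ?_)
      (integrable_remaining p T n fun Q => potential p i (T i) n (T i ∩ Q))
      (ae_of_all _ fun c => integral_potential_serve_le hT hT0 _ i n))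
    exact integral_nonneg fun d => by simp only [Pi.zero_apply, potential]; positivity

/-- Once the time covers all expected delivery times, the delay is at least that of the remaining
targets, and each of these needs at least the inverse of the current rate. -/
lemma sq_add_le_potential {i : Fin N} {A D : Finset (Fin M)} (hDA : D ⊆ A)
    (hA : ∀ j ∈ A, (p i j : ℝ) ≠ 0) {n : ℕ} (hn : ∑ j ∈ A, (p i j : ℝ)⁻¹ ≤ n) :
    (D.card : ℝ) ^ 2 ≤ potential p i A n D := by
  have h1 : (D.card : ℝ) ≤ rate p i D * (n - ∑ j ∈ A \ D, (p i j : ℝ)⁻¹) := by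
    calc (D.card : ℝ) = ∑ j ∈ D, 1 := by simp
      _ ≤ ∑ j ∈ D, rate p i D * (p i j : ℝ)⁻¹ := by
          refine Finset.sum_le_sum fun j hj => ?_
          have hp0 : (0 : ℝ) < p i j := (p i j).2.1.lt_of_ne' (hA j (hDA hj))
          rw [← div_eq_mul_inv, one_le_div hp0]
          exact le_rate hj
      _ = rate p i D * ∑ j ∈ D, (p i j : ℝ)⁻¹ := (Finset.mul_sum _ _ _).symm
      _ ≤ _ := by
          refine mul_le_mul_of_nonneg_left ?_ (rate_nonneg p i D)
          rw [← Finset.sum_sdiff hDA] at hn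
          linarith
  unfold potential
  have := pow_le_pow_left₀ (Nat.cast_nonneg D.card) h1 2
  linarith [Nat.cast_nonneg (α := ℝ) D.card]

/-- If the targets fit into the interval on average, then the expected number of targets that
remain undelivered is at most the square root of the numbers of access points times targets. -/
theorem integral_card_remaining_le (hT : ∀ i, ∀ j ∈ T i, home j = i)
    (hT0 : ∀ i, ∀ j ∈ T i, (p i j : ℝ) ≠ 0) (hTτ : ∀ i, ∑ j ∈ T i, (p i j : ℝ)⁻¹ ≤ τ) :
    ∫ c, ∑ i, ((T i ∩ remaining p T (fun s i j => c (s, i, j)) τ).card : ℝ) ∂(channelLaw p) ≤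
      √(N * ∑ i, ((T i).card : ℝ)) := by
  set f : Finset (Fin M) → ℝ := fun Q => ∑ i, ((T i ∩ Q).card : ℝ) with hf
  set R : Outcomes N M → Finset (Fin M) :=
    fun c => remaining p T (fun s i j => c (s, i, j)) τ with hR
  have hint : ∀ g : Finset (Fin M) → ℝ, Integrable (fun c => g (R c)) (channelLaw p) :=
    integrable_remaining p T τ
  refine Real.le_sqrt_of_sq_le ?_
  have hvar : (∫ c, f (R c) ∂(channelLaw p)) ^ 2 ≤ ∫ c, f (R c) ^ 2 ∂(channelLaw p) := by
    set m := ∫ c, f (R c) ∂(channelLaw p) with hm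
    have h1 : 0 ≤ ∫ c, (f (R c) - m) ^ 2 ∂(channelLaw p) := integral_nonneg fun c => sq_nonneg _
    have h2 : ∫ c, (f (R c) - m) ^ 2 ∂(channelLaw p) =
        ∫ c, f (R c) ^ 2 ∂(channelLaw p) - m ^ 2 := by
      have : ∀ c, (f (R c) - m) ^ 2 = f (R c) ^ 2 - (2 * m * f (R c) - m ^ 2) := fun c => by ring
      simp_rw [this]
      rw [integral_sub (hint fun Q => f Q ^ 2) (hint fun Q => 2 * m * f Q - m ^ 2),
        integral_sub ((hint f).const_mul _) (integrable_const _), integral_const_mul, ← hm]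
      simp
      ring
    linarith
  refine hvar.trans ?_
  -- Cauchy–Schwarz over the access points produces the factor `N`.
  have hpt : ∀ c, f (R c) ^ 2 ≤ N * ∑ i, potential p i (T i) τ (T i ∩ R c) := by
    intro c
    have h1 := sq_sum_le_card_mul_sum_sq (s := (Finset.univ : Finset (Fin N)))
      (f := fun i => ((T i ∩ R c).card : ℝ))
    rw [Finset.card_univ, Fintype.card_fin] at h1
    refine h1.trans (mul_le_mul_of_nonneg_left ?_ (Nat.cast_nonneg _))
    exact Finset.sum_le_sum fun i _ =>
      sq_add_le_potential Finset.inter_subset_left (hT0 i) (hTτ i)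
  have hpi := fun i => hint fun Q => potential p i (T i) τ (T i ∩ Q)
  calc ∫ c, f (R c) ^ 2 ∂(channelLaw p)
      ≤ ∫ c, N * ∑ i, potential p i (T i) τ (T i ∩ R c) ∂(channelLaw p) :=
        integral_mono (hint fun Q => f Q ^ 2)
          ((integrable_finsetSum _ fun i _ => hpi i).const_mul _) hpt
    _ = N * ∑ i, ∫ c, potential p i (T i) τ (T i ∩ R c) ∂(channelLaw p) := by
        rw [integral_const_mul, integral_finsetSum _ fun i _ => hpi i]
    _ ≤ _ := mul_le_mul_of_nonneg_left
        (Finset.sum_le_sum fun i _ => integral_potential_le hT hT0 i τ) (Nat.cast_nonneg _)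

/-- Each undelivered target costs at most `W`, so the expected loss is at most `W` times the
expected number of leftovers. -/
lemma sum_targets_sub_le {w : Fin M → ℝ} {W : ℝ} (hw : ∀ j, 0 ≤ w j) (hwW : ∀ j, w j ≤ W)
    (hW : 0 ≤ W) (hT : ∀ i, ∀ j ∈ T i, home j = i)
    (hT0 : ∀ i, ∀ j ∈ T i, (p i j : ℝ) ≠ 0) (hTτ : ∀ i, ∑ j ∈ T i, (p i j : ℝ)⁻¹ ≤ τ) :
    ∑ i, ∑ j ∈ T i, w j - W * √(N * ∑ i, ((T i).card : ℝ)) ≤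
      ∑ j, w j * deliveryProb τ p T j := by
  set R : Outcomes N M → Finset (Fin M) :=
    fun c => remaining p T (fun s i j => c (s, i, j)) τ with hR
  have hint : ∀ g : Finset (Fin M) → ℝ, Integrable (fun c => g (R c)) (channelLaw p) :=
    integrable_remaining p T τ
  have hpt : ∀ Q : Finset (Fin M), ∑ i, ∑ j ∈ T i, w j - W * ∑ i, ((T i ∩ Q).card : ℝ) ≤
      ∑ j, w j * if j ∈ Q then (0 : ℝ) else 1 := by
    intro Q
    rw [← Finset.sum_fiberwise Finset.univ home, Finset.mul_sum, ← Finset.sum_sub_distrib]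
    refine Finset.sum_le_sum fun i _ => ?_
    have hsub : T i ⊆ Finset.univ.filter fun j => home j = i := fun j hj => by simp [hT i j hj]
    calc ∑ j ∈ T i, w j - W * ((T i ∩ Q).card : ℝ)
        = ∑ j ∈ T i, (w j - if j ∈ Q then W else 0) := by
          rw [Finset.sum_sub_distrib, Finset.sum_ite_mem]
          simp [mul_comm]
      _ ≤ ∑ j ∈ T i, w j * if j ∈ Q then (0 : ℝ) else 1 := by
          refine Finset.sum_le_sum fun j _ => ?_
          split_ifs <;> simp [hwW j]
      _ ≤ _ := Finset.sum_le_sum_of_subset_of_nonneg hsub fun j _ _ =>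
          mul_nonneg (hw j) (by split_ifs <;> norm_num)
  have h1 : ∑ j, w j * deliveryProb τ p T j =
      ∫ c, ∑ j, w j * (if j ∈ R c then (0 : ℝ) else 1) ∂(channelLaw p) := by
    rw [integral_finsetSum _ fun j _ => (hint fun Q => if j ∈ Q then 0 else 1).const_mul _]
    simp_rw [integral_const_mul]
    rfl
  have h2 := integral_mono
    (hint fun Q => ∑ i, ∑ j ∈ T i, w j - W * ∑ i, ((T i ∩ Q).card : ℝ))
    (hint fun Q => ∑ j, w j * if j ∈ Q then (0 : ℝ) else 1) (fun c => hpt (R c))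
  rw [integral_sub (integrable_const _) ((hint fun Q => ∑ i, ((T i ∩ Q).card : ℝ)).const_mul _),
    integral_const_mul] at h2
  simp only [integral_const, probReal_univ, one_smul] at h2
  rw [h1]
  refine le_trans ?_ h2
  have h3 := mul_le_mul_of_nonneg_left (integral_card_remaining_le hT hT0 hTτ) hW
  linarith

end BestFirst

/-- Every feasible point of the relaxed problem is almost attained by a policy. -/
lemma IsFeasible.exists_policy {τ : ℕ} (hN : 0 < N) {p : Channels N M} {w : Fin M → ℝ} {W : ℝ}
    (hw : ∀ j, 1 ≤ w j) (hwW : ∀ j, w j ≤ W) (hW : 0 ≤ W) {x : Fin N → Fin M → ℝ}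
    (hx : IsFeasible τ p x) :
    ∃ η : Policy N M, HasLongTermAverages τ p η ∧
      ∑ i, ∑ j, x i j * w j - W * √(N * ∑ i, ∑ j, x i j * w j) ≤
        ∑ j, w j * timelyThroughput τ p η j := by
  classical
  have hw0 : ∀ j, 0 ≤ w j := fun j => zero_le_one.trans (hw j)
  have : Nonempty (Fin N) := ⟨⟨0, hN⟩⟩
  set T : Fin N → Finset (Fin M) := fun i => Finset.univ.filter fun j => x i j = 1 with hTdef
  have hxT : ∀ i j, x i j = if j ∈ T i then 1 else 0 := by
    intro i j
    rcases hx.zero_or_one i j with h | h <;> simp [hTdef, h]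
  have huniq : ∀ j, ∀ i i', j ∈ T i → j ∈ T i' → i = i' := by
    intro j i i' hi hi'
    by_contra hne
    have h1 : ∑ k ∈ {i, i'}, x k j ≤ ∑ k, x k j :=
      Finset.sum_le_sum_of_subset_of_nonneg (Finset.subset_univ _) fun k _ _ => hx.nonneg k j
    rw [Finset.sum_pair hne, hxT, hxT, if_pos hi, if_pos hi'] at h1
    linarith [hx.at_most_one_bin j]
  -- Clients in no bin get an arbitrary home and are never served.
  obtain ⟨home, hT⟩ : ∃ home : Fin M → Fin N, ∀ i, ∀ j ∈ T i, home j = i := by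
    have : ∀ j, ∃ i₀, ∀ i, j ∈ T i → i₀ = i := by
      intro j
      by_cases h : ∃ i, j ∈ T i
      · obtain ⟨i, hi⟩ := h
        exact ⟨i, fun i' hi' => huniq j i i' hi hi'⟩
      · exact ⟨Classical.arbitrary _, fun i hi => (h ⟨i, hi⟩).elim⟩
    choose home hhome using this
    exact ⟨home, fun i j hj => hhome j i hj⟩
  have hT0 : ∀ i, ∀ j ∈ T i, (p i j : ℝ) ≠ 0 := by
    intro i j hj h0
    have := hx.no_link i j h0
    rw [hxT, if_pos hj] at this
    exact one_ne_zero this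
  have hTτ : ∀ i, ∑ j ∈ T i, (p i j : ℝ)⁻¹ ≤ τ := by
    intro i
    have := hx.capacity i
    simp_rw [hxT i] at this
    simpa [ite_div, Finset.sum_ite_mem] using this
  have hval : ∑ i, ∑ j, x i j * w j = ∑ i, ∑ j ∈ T i, w j := by
    simp_rw [hxT]
    simp [Finset.sum_ite_mem]
  refine ⟨bestFirst τ p T home, hasLongTermAverages_bestFirst hT, ?_⟩
  have h1 := sum_targets_sub_le (τ := τ) hw0 hwW hW hT hT0 hTτ
  have h2 : ∑ j, w j * deliveryProb τ p T j ≤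
      ∑ j, w j * timelyThroughput τ p (bestFirst τ p T home) j :=
    Finset.sum_le_sum fun j _ =>
      mul_le_mul_of_nonneg_left (deliveryProb_le_timelyThroughput hT j) (hw0 j)
  -- Here weights at least `1` turn the number of targets into their value.
  have h3 : ∑ i, ((T i).card : ℝ) ≤ ∑ i, ∑ j ∈ T i, w j := by
    refine Finset.sum_le_sum fun i _ => ?_
    calc ((T i).card : ℝ) = ∑ j ∈ T i, 1 := by simp
      _ ≤ _ := Finset.sum_le_sum fun j _ => hw j
  have h4 : √(N * ∑ i, ((T i).card : ℝ)) ≤ √(N * ∑ i, ∑ j ∈ T i, w j) :=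
    Real.sqrt_le_sqrt (mul_le_mul_of_nonneg_left h3 (Nat.cast_nonneg _))
  have h5 := mul_le_mul_of_nonneg_left h4 hW
  rw [hval]
  linarith

/-- Some policy with long-term averages exceeds the lower bound. -/
lemma exists_policy_gt {τ : ℕ} (hN : 0 < N) (p : Channels N M) {w : Fin M → ℝ} {W : ℝ}
    (hw : ∀ j, 1 ≤ w j) (hwW : ∀ j, w j ≤ W) (hW : 0 < W) :
    ∃ η : Policy N M, HasLongTermAverages τ p η ∧
      weightedDet τ p w - 2 * W * √(N * (weightedDet τ p w + N / 4)) <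
        ∑ j, w j * timelyThroughput τ p η j := by
  have hw0 : ∀ j, 0 ≤ w j := fun j => zero_le_one.trans (hw j)
  have hD := weightedDet_nonneg τ p hw0
  have hN' : (0 : ℝ) < N := Nat.cast_pos.2 hN
  have hs : 0 < √(N * (weightedDet τ p w + N / 4)) := Real.sqrt_pos.2 (by positivity)
  -- One half of the factor `2` pays for a merely near-optimal `x`, the other for the packets lost.
  -- The term `N / 4` keeps the root positive even if the relaxed value is `0`.
  obtain ⟨_, ⟨x, hx, rfl⟩, hlt⟩ := exists_lt_of_lt_csSup
    (s := {v : ℝ | ∃ x : Fin N → Fin M → ℝ, IsFeasible τ p x ∧ v = ∑ i, ∑ j, x i j * w j})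
    ⟨_, 0, isFeasible_zero τ p, rfl⟩ (sub_lt_self (weightedDet τ p w) (mul_pos hW hs))
  obtain ⟨η, hη, hval⟩ := hx.exists_policy hN hw hwW hW.le
  refine ⟨η, hη, lt_of_lt_of_le ?_ hval⟩
  have h1 : √(N * ∑ i, ∑ j, x i j * w j) ≤ √(N * (weightedDet τ p w + N / 4)) :=
    Real.sqrt_le_sqrt (mul_le_mul_of_nonneg_left
      ((hx.le_weightedDet hw0).trans (by linarith)) hN'.le)
  have h2 := mul_le_mul_of_nonneg_left h1 hW.le
  linarith

end TimelyThroughput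

end

/-! ### Bounds for both capacities -/

theorem theorem4 {N M τ : ℕ} (hN : 0 < N) (hM : 0 < M) (hτ : 0 < τ)
    (p : TimelyThroughput.Channels N M) (w : Fin M → ℝ) (hw : ∀ j, 1 ≤ w j) :
    (TimelyThroughput.weightedDet τ p w
          - 2 * (⨆ j, w j) * √(N * (TimelyThroughput.weightedDet τ p w + N / 4))
        < TimelyThroughput.weightedCapacity τ p w ∧
      TimelyThroughput.weightedCapacity τ p w
        < TimelyThroughput.weightedDet τ p w + N * ⨆ j, w j) ∧
    (TimelyThroughput.weightedDet τ p w
          - 2 * (⨆ j, w j) * √(N * (TimelyThroughput.weightedDet τ p w + N / 4))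
        < TimelyThroughput.weightedCapacityOfLimits τ p w ∧
      TimelyThroughput.weightedCapacityOfLimits τ p w
        < TimelyThroughput.weightedDet τ p w + N * ⨆ j, w j) := by
  have hw0 : ∀ j, 0 ≤ w j := fun j => zero_le_one.trans (hw j)
  have hwW : ∀ j, w j ≤ ⨆ j, w j := fun j => le_ciSup (Set.finite_range w).bddAbove j
  have hW : 0 < ⨆ j, w j := zero_lt_one.trans_le ((hw ⟨0, hM⟩).trans (hwW _))
  obtain ⟨η, hη, hlow⟩ := TimelyThroughput.exists_policy_gt (τ := τ) hN p hw hwW hW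
  obtain ⟨B, hB0, hBlt, hB⟩ := TimelyThroughput.exists_interval_bound (τ := τ) hN p hW
    (fun j => zero_lt_one.trans_le (hw j)) hwW
  have hle : ∀ η, TimelyThroughput.weightedThroughput τ p w η ≤ B := fun η =>
    TimelyThroughput.weightedThroughput_le p hw0 η hB0 (hB η)
  have hsum : ∀ η : {η // TimelyThroughput.HasLongTermAverages τ p η},
      ∑ j, w j * TimelyThroughput.timelyThroughput τ p η.1 j ≤
        TimelyThroughput.weightedThroughput τ p w η.1 := fun η =>
    TimelyThroughput.sum_timelyThroughput_le_weightedThroughput p hw0 η.2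
  have hcap : TimelyThroughput.weightedThroughput τ p w η ≤
      TimelyThroughput.weightedCapacity τ p w :=
    le_ciSup ⟨B, by rintro _ ⟨η, rfl⟩; exact hle η⟩ η
  have hcapL : ∑ j, w j * TimelyThroughput.timelyThroughput τ p η j ≤
      TimelyThroughput.weightedCapacityOfLimits τ p w :=
    le_ciSup (f := fun η : {η // TimelyThroughput.HasLongTermAverages τ p η} =>
      ∑ j, w j * TimelyThroughput.timelyThroughput τ p η.1 j)
      ⟨B, by rintro _ ⟨η, rfl⟩; exact (hsum η).trans (hle η.1)⟩ ⟨η, hη⟩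
  -- The same policy `η` and the same `B` settle both pairs of bounds, since `hsum` compares the two
  -- objectives.
  refine ⟨⟨hlow.trans_le ((hsum ⟨η, hη⟩).trans hcap), lt_of_le_of_lt ?_ hBlt⟩,
    hlow.trans_le hcapL, lt_of_le_of_lt ?_ hBlt⟩
  · exact Real.iSup_le hle hB0
  · exact Real.iSup_le (fun η => (hsum η).trans (hle η.1)) hB0
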